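/- **Setting.** Let $G$ be a connected graph on $[n]=\{1,\dots,n\}$, $n\ge 2$, with maximum degree $\Delta$. A set $S$ separates $A$ and $A'$ (arbitrary subsets of $[n]$) if every path of $G$ from a vertex of $A$ to a vertex of $A'$ (one-vertex paths included) contains a vertex of $S$. Let $M^1(G)$ be the set of symmetric positive definite real $n\times n$ matrices $\Sigma$ with $(\Sigma^{-1})_{ij}=0$ whenever $i\ne j$ and $ij$ is not an edge of $G$, and such that for all $A,A',S\subseteq[n]$ with $|S|\le 1$, $$\operatorname{rank}(\Sigma_{A\cup S,A'\cup S})=|S|\iff S\text{ separates }A\text{ and }A'\text{ in }G .$$ **Algorithm.** The graph is unknown and the entries of $\Sigma$ are available through queries. The query complexity of a run is the number of entries queried, repetitions counted. All random draws are uniform and independent of the past. For $v\in[n]$ write $\Sigma^{(v)}_{ij}=\Sigma_{ij}-\Sigma_{iv}\Sigma_{vj}/\Sigma_{vv}$; one such entry costs four queries. * $\mathrm{Components}(\Sigma^{(v)},A)$: as long as $A\neq\emptyset$, draw $i\in A$, output $C=\{i\}\cup\{j\in A\setminus\{i\}:\Sigma^{(v)}_{ji}\ne0\}$, and replace $A$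 by $A\setminus C$. * $\mathrm{TestTree}(B,m)$, for $B\subseteq[n]$: 1. If $|B|\le m$, query all of $\Sigma_{B,B}$ and accept if and only if the graph on $B$ whose edges are the positions of the nonzero off-diagonal entries of $(\Sigma_{B,B})^{-1}$ is a tree. 2. If $|B|>m$, draw an $m$-element set $W\subseteq B$. For each $v\in B$ run $\mathrm{Components}(\Sigma^{(v)},W\setminus\{v\})$ and put $\widehat M(v)=|B|\max_C|C|/|W|$, the maximum being over the sets $C$ that it outputs. If $\min_{v\in B}\widehat M(v)>|B|/2$, reject. Otherwise let $v^*$ be a minimizer of $\widehat M$ over $B$ (ties are broken by an arbitrary fixed rule, which may depend on $B$, $W$ and the set of minimizers), let $C_1,\dots,C_\ell$ be the output of $\mathrm{Components}(\Sigma^{(v^*)},B\setminus\{v^*\})$, and run $\mathrm{TestTree}(C_i\cup\{v^*\},m)$ for $i=1,\dots,\ell$ one after the other. As soon as one of these rejects, stop and reject; if all accept, accept. **Theorem.** There is an absolute constant $K>0$ such that the following holds for every $n\ge2$, every connected graph $G$ on $[n]$, every $\Sigma\in M^1(G)$, every $0<\epsilon<1$ and every tie-breaking rule. Let $$m=\Big\lceil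 18\log\Big(\frac{5n^2}{\epsilon}\log n\Big)\Big\rceil .$$ 1. $\mathrm{TestTree}([n],m)$ terminates whatever the random draws are, with at most $n$ nested calls, and it accepts if and only if $G$ is a tree. 2. With probability at least $1-\epsilon$ its query complexity is at most $K\,n\log n\,\big(m\min\{m,\Delta\}+\Delta\big)$. 3. The two quantities $$n\log n\,\big(m\min\{m,\Delta\}+\Delta\big)\quad\text{and}\quad n\log n\,\big(\log(n/\epsilon)\min\{\log(n/\epsilon),\Delta\}+\Delta\big)$$ are each at most $K$ times the other. -/

import Mathlib

noncomputable section

namespace TreeTest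

/-! ### The graphical model and faithfulness -/

/-- `S` separates `A` from `A'` in `G`: every walk (equivalently, every path, including the
one-vertex ones) from a vertex of `A` to a vertex of `A'` contains a vertex of `S`. -/
def Separates {V : Type} (G : SimpleGraph V) (S A A' : Finset V) : Prop :=
  ∀ a ∈ A, ∀ b ∈ A', ∀ p : G.Walk a b, ∃ s ∈ S, s ∈ p.support

/-- `M(G)`: the symmetric positive definite matrices whose inverse vanishes at every pair of
distinct non-adjacent vertices. -/
def model {V : Type} [Fintype V] [DecidableEq V] (G : SimpleGraph V) : Set (Matrix V V ℝ) :=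
  {Cov | Cov.PosDef ∧ ∀ i j, i ≠ j → ¬ G.Adj i j → Cov⁻¹ i j = 0}

/-- `M^τ(G)`: the `τ`-faithful members of `M(G)`. For all `A, A', S` with `|S| ≤ τ`, the submatrix
with rows `A ∪ S` and columns `A' ∪ S` has rank `|S|` if and only if `S` separates `A, A'`. -/
def faithfulModel {V : Type} [Fintype V] [DecidableEq V] (τ : ℕ) (G : SimpleGraph V) :
    Set (Matrix V V ℝ) :=
  {Cov | Cov ∈ model G ∧ ∀ A A' S : Finset V, S.card ≤ τ →
    ((Cov.submatrix (fun i : ↥(A ∪ S) => (i : V)) (fun j : ↥(A' ∪ S) => (j : V))).rank = S.card ↔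
      Separates G S A A')}

/-! ### Randomized sequential algorithms with access to a matrix oracle -/

/-- A randomized sequential algorithm that returns a value in `α` and whose only access to the
unknown `V × V` matrix is by querying single entries. -/
inductive Comp (V α : Type) : Type
  /-- Stop and return a value. -/
  | ret (a : α) : Comp V α
  /-- Query the entry `(i, j)` and continue with the answer. -/
  | query (i j : V) (k : ℝ → Comp V α) : Comp V α
  /-- Draw a uniform element of `{0, …, N}`, independently of the past, and continue with it. -/
  | draw (N : ℕ) (k : Fin (N + 1) → Comp V α) : Comp V α

namespace Comp

variable {V α β : Type}

/-- Sequential composition. -/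
def bind : Comp V α → (α → Comp V β) → Comp V β
  | ret a, f => f a
  | query i j k, f => query i j (fun x => bind (k x) f)
  | draw N k, f => draw N (fun r => bind (k r) f)

instance : Monad (Comp V) where
  pure := ret
  bind := bind

/-- The joint law of the output and of the number of queries made (a repeated query counts each
time), when the queries are answered by `Cov`. -/
def run (Cov : Matrix V V ℝ) : Comp V α → PMF (α × ℕ)
  | ret a => PMF.pure (a, 0)
  | query i j k => (run Cov (k (Cov i j))).map (fun x => (x.1, x.2 + 1))
  | draw N k => (PMF.uniformOfFintype (Fin (N + 1))).bind (fun r => run Cov (k r))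

/-- Query one entry. -/
def ask (i j : V) : Comp V ℝ := query i j ret

/-- Draw a uniform element of a nonempty finite set. -/
def uniform (s : Finset α) (hs : s.Nonempty) : Comp V {x // x ∈ s} :=
  draw (s.card - 1) (fun r =>
    ret (s.equivFin.symm (Fin.cast (Nat.sub_add_cancel hs.card_pos) r)))

/-- Run `f v` for every `v` in the list and record the results as a function of `v`
(with a default value off the list). -/
def collect [DecidableEq V] [Inhabited α] (f : V → Comp V α) : List V → Comp V (V → α)
  | [] => pure (fun _ => default)
  | v :: vs => do
    let x ← f v
    let g ← collect f vs
    pure (Function.update g v x)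

end Comp

variable {V : Type} [DecidableEq V]

/-! ### The algorithm -/

/-- The entry `(i, j)` of the conditional covariance matrix
`Σ^(v) = Σ - Σ_{·,v} Σ_{v,·} / Σ_{v,v}`, obtained by four queries of `Σ`. -/
def condEntry (v i j : V) : Comp V ℝ := do
  let a ← Comp.ask i j
  let b ← Comp.ask i v
  let c ← Comp.ask v j
  let e ← Comp.ask v v
  pure (a - b * c / e)

theorem card_sdiff_insert_lt {A : Finset V} {i : V} (hi : i ∈ A) (T : Finset V) :
    (A \ insert i T).card < A.card :=
  Finset.card_lt_card (Finset.ssubset_iff_subset_ne.2 ⟨Finset.sdiff_subset, fun h =>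
    (Finset.mem_sdiff.1 (h.symm.subset hi)).2 (Finset.mem_insert_self _ _)⟩)

/-- `Components`: while the set `A` of remaining vertices is nonempty, take a random `i ∈ A`,
look at the entries `(j, i)`, `j ∈ A \ {i}`, of the matrix given by `entry`, output the
set `C` consisting of `i` and of the support of this vector, and go on with `A \ C`. -/
def components (entry : V → V → Comp V ℝ) (A : Finset V) : Comp V (List (Finset V)) :=
  if hA : A.Nonempty then
    Comp.bind (Comp.uniform A hA) fun i =>
    Comp.bind (Comp.collect (fun j => entry j i.1) (A.erase i.1).toList) fun x =>
    Comp.bind (components entry (A \ insert i.1 ((A.erase i.1).filter (fun j => x j ≠ 0)))) fun Cs =>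
    Comp.ret (insert i.1 ((A.erase i.1).filter (fun j => x j ≠ 0)) :: Cs)
  else Comp.ret []
termination_by A.card
decreasing_by exact card_sdiff_insert_lt i.2 _

/-- The estimate `|B| · max_C |C ∩ W| / |W|`, where `Cs` lists the sets `C ∩ W`. -/
def estimate (B W : Finset V) (Cs : List (Finset V)) : ℚ :=
  (B.card : ℚ) * ((Cs.foldr (fun C r => max C.card r) 0 : ℕ) : ℚ) / (W.card : ℚ)

/-- `FindBalancedPartitionTree` on the principal submatrix indexed by `B`. It returns `none` when
it breaks (all estimates exceed `|B| / 2`). The rule `tie` selects one of the minimizers of the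
estimate; it may depend on `B` and on the sample `W`. -/
def findBalancedPartitionTree (tie : Finset V → Finset V → Finset V → V) (m : ℕ) (B : Finset V)
    (hm : m ≤ B.card) : Comp V (Option (V × List (Finset V))) := do
  let W ← Comp.uniform (B.powersetCard m) (Finset.powersetCard_nonempty.2 hm)
  let Mhat ← Comp.collect (fun v => do
    let Cs ← components (condEntry v) (W.1.erase v)
    pure (estimate B W.1 Cs)) B.toList
  let vstar := tie B W.1 (B.filter (fun v => ∀ u ∈ B, Mhat v ≤ Mhat u))
  if (B.card : ℚ) / 2 < Mhat vstar then
    pure none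
  else do
    let Cs ← components (condEntry vstar) (B.erase vstar)
    pure (some (vstar, Cs))

open Classical in
/-- The direct test: query the whole submatrix indexed by `B`, invert it, and check whether the
graph given by the off-diagonal support of the inverse is a tree. -/
def directTest (B : Finset V) : Comp V Bool := do
  let x ← Comp.collect (fun i => Comp.collect (fun j => Comp.ask i j) B.toList) B.toList
  pure (decide (SimpleGraph.fromRel (fun i j : B =>
    (Matrix.of (fun i j : B => x i.1 j.1))⁻¹ i j ≠ 0)).IsTree)

/-- Run the tests of a list one after the other and stop at the first one that does not accept. -/
def allAccept : List (Comp V (Option Bool)) → Comp V (Option Bool)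
  | [] => pure (some true)
  | p :: ps => do
    let r ← p
    if r = some true then allAccept ps else pure r

/-- `TestTree` on the principal submatrix indexed by `B`: `some true` means that it accepts (tree)
and `some false` that it rejects (not a tree). The recursion is unfolded to depth `d`; the
value `none` means that this depth was exceeded. -/
def testTree (tie : Finset V → Finset V → Finset V → V) (m : ℕ) :
    ℕ → Finset V → Comp V (Option Bool)
  | 0, _ => pure none
  | d + 1, B =>
    if h : B.card ≤ m then do
      let b ← directTest B
      pure (some b)
    else do
      let r ← findBalancedPartitionTree tie m B (not_le.1 h).le
      match r with
      | none => pure (some false)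
      | some (v, Cs) => allAccept (Cs.map (fun C => testTree tie m d (insert v C)))

end TreeTest

end

/-! Faithfulness turns entries into connectivity. With `S = ∅` it makes every entry of `Cov`
nonzero, because `G` is connected. With `S = {v}` it makes the conditional entry `(i, j)` nonzero
exactly when some walk from `i` to `j` avoids `v`. Hence `components` surely finds the traces of the
components of `G - v`, and chance affects only the cost, never the answer.

Correctness. Every set `B` met by the recursion is closed under simple paths of `G`, and
cycle-freeness on `B` is equivalent to cycle-freeness on all the pieces `insert v C`
(`cycleFreeOn_iff_forall_isPartition`). Rejecting when no estimate is small is sound because a tree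
has a centroid for the weight that counts sample points (`exists_centroid`). In the base case,
marginalizing to a path-closed set keeps the off-diagonal precisions (`inv_of_apply`), so the
inverse graph is a subgraph of `G`. It may miss edges where the precision happens to vanish, but not
if it is a tree (`adj_inverseGraph_of_isTree`). Each accepted split has at least two classes, so the
sets shrink and the recursion ends.

Cost. A sample is bad if some class with at least 7/8 of `B` contains at most half of it; this has
probability at most `n / 2 ^ ⌈m/2⌉`. After a good sample each class has at most 9/10 of `b = |B| -
1` vertices, and the potential `queryBound` falls by enough to pay for the call. The values of `b`
of the pieces add up to that of `B`, and a union bound over fewer than `n` splits bounds the failure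
probability. -/

noncomputable section

namespace TreeTest

open SimpleGraph

open scoped ENNReal

/-! ### Outcomes and query counts of a randomized algorithm, up to a failure probability -/

/-- Run against `Cov`, the algorithm `c` returns an output and makes a number of queries that
satisfy `Q`, except with probability at most `δ`. -/
def HoldsUpTo {V α : Type} (Cov : Matrix V V ℝ) (δ : ℝ≥0∞) (c : Comp V α) (Q : α → ℕ → Prop) :
    Prop :=
  (c.run Cov).toOuterMeasure {x | ¬ Q x.1 x.2} ≤ δ

namespace HoldsUpTo

variable {V α β : Type} {Cov : Matrix V V ℝ} {δ δ' : ℝ≥0∞} {c : Comp V α} {Q Q' : α → ℕ → Prop}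

theorem mono (h : HoldsUpTo Cov δ c Q) (hδ : δ ≤ δ') (hQ : ∀ a q, Q a q → Q' a q) :
    HoldsUpTo Cov δ' c Q' :=
  ((MeasureTheory.measure_mono
    (Set.ofPred_subset_ofPred.2 fun _ hx hQx => hx (hQ _ _ hQx))).trans h).trans hδ

theorem imp (h : HoldsUpTo Cov δ c Q) (hQ : ∀ a q, Q a q → Q' a q) : HoldsUpTo Cov δ c Q' :=
  h.mono le_rfl hQ

theorem zero_iff : HoldsUpTo Cov 0 c Q ↔ ∀ x ∈ (c.run Cov).support, Q x.1 x.2 := by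
  rw [HoldsUpTo, nonpos_iff_eq_zero, PMF.toOuterMeasure_apply_eq_zero_iff, Set.disjoint_left]
  simp only [Set.mem_ofPred_eq, not_not]

theorem one_sub_le (h : HoldsUpTo Cov δ c Q) :
    1 - δ ≤ (c.run Cov).toOuterMeasure {x | Q x.1 x.2} := by
  rw [tsub_le_iff_right]
  have huniv : (c.run Cov).toOuterMeasure Set.univ = 1 :=
    (PMF.toOuterMeasure_apply_eq_one_iff _ _).2 (Set.subset_univ _)
  rw [← huniv]
  refine le_trans (MeasureTheory.measure_mono ?_)
    ((MeasureTheory.measure_union_le _ _).trans (add_le_add le_rfl h))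
  intro x _
  exact em _

theorem ret {a : α} (h : Q a 0) : HoldsUpTo Cov δ (Comp.ret a) Q := by
  refine HoldsUpTo.mono (δ := 0) (zero_iff.2 ?_) bot_le fun _ _ => id
  intro x hx
  simp only [Comp.run, PMF.support_pure, Set.mem_singleton_iff] at hx
  subst hx
  exact h

theorem run_bind (c : Comp V α) (f : α → Comp V β) :
    (c.bind f).run Cov =
      (c.run Cov).bind fun x => ((f x.1).run Cov).map fun y => (y.1, x.2 + y.2) := by
  induction c with
  | ret a =>
    simp only [Comp.bind, Comp.run, PMF.pure_bind, zero_add]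
    exact (PMF.map_id _).symm
  | query i j k ih =>
    simp only [Comp.bind, Comp.run, ih, PMF.map_bind, PMF.bind_map, PMF.map_comp]
    congr 1
    funext x
    simp only [Function.comp_apply]
    congr 1
    funext y
    simp only [Function.comp_apply]
    congr 1
    omega
  | draw N k ih => simp only [Comp.bind, Comp.run, ih, PMF.bind_bind]

/-- Union bound: runs of `c` that violate `Q` have mass at most `δ`, and every other run fails
afterwards with conditional probability at most `δ'`. -/
theorem bind {f : α → Comp V β} {R : β → ℕ → Prop} (h : HoldsUpTo Cov δ c Q)
    (hf : ∀ a q, Q a q → HoldsUpTo Cov δ' (f a) fun b q' => R b (q + q')) :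
    HoldsUpTo Cov (δ + δ') (c.bind f) R := by
  classical
  rw [HoldsUpTo, run_bind, PMF.toOuterMeasure_bind_apply]
  have hbound : ∀ x : α × ℕ, (c.run Cov) x *
      (((f x.1).run Cov).map fun y => (y.1, x.2 + y.2)).toOuterMeasure {x | ¬ R x.1 x.2} ≤
      Set.indicator {x | ¬ Q x.1 x.2} (c.run Cov) x + (c.run Cov) x * δ' := by
    intro x
    by_cases hx : Q x.1 x.2
    · refine le_add_left (mul_le_mul_right ?_ _)
      rw [PMF.toOuterMeasure_map_apply]
      exact hf _ _ hx
    · rw [Set.indicator_of_mem (by exact hx)]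
      refine le_add_right (mul_le_of_le_one_right' ?_)
      rw [← (PMF.toOuterMeasure_apply_eq_one_iff _ _).2 (Set.subset_univ
        (((f x.1).run Cov).map fun y => (y.1, x.2 + y.2)).support)]
      exact MeasureTheory.measure_mono (Set.subset_univ _)
  refine (ENNReal.tsum_le_tsum hbound).trans ?_
  rw [ENNReal.tsum_add, ENNReal.tsum_mul_right, PMF.tsum_coe, one_mul,
    ← PMF.toOuterMeasure_apply]
  exact add_le_add_left h _

theorem bind_zero {f : α → Comp V β} {R : β → ℕ → Prop} (h : HoldsUpTo Cov 0 c Q)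
    (hf : ∀ a q, Q a q → HoldsUpTo Cov δ (f a) fun b q' => R b (q + q')) :
    HoldsUpTo Cov δ (c.bind f) R := by
  simpa using h.bind hf

theorem ask (i j : V) : HoldsUpTo Cov 0 (Comp.ask i j) fun x q => x = Cov i j ∧ q = 1 := by
  rw [zero_iff]
  intro x hx
  simp only [Comp.ask, Comp.run, PMF.pure_map, PMF.support_pure, Set.mem_singleton_iff] at hx
  subst hx
  exact ⟨rfl, rfl⟩

theorem uniform [DecidableEq α] (s : Finset α) (hs : s.Nonempty) (P : α → Prop) [DecidablePred P]
    (hP : ((s.filter fun a => ¬ P a).card : ℝ≥0∞) / s.card ≤ δ) :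
    HoldsUpTo Cov δ (Comp.uniform s hs) fun a q => P a.1 ∧ q = 0 := by
  classical
  have hrun : (Comp.uniform (V := V) s hs).run Cov =
      (PMF.uniformOfFintype (Fin (s.card - 1 + 1))).map fun r =>
        (s.equivFin.symm (Fin.cast (Nat.sub_add_cancel hs.card_pos) r), 0) := by
    simp only [Comp.uniform, Comp.run]
    rfl
  rw [HoldsUpTo, hrun, PMF.toOuterMeasure_map_apply]
  have hcard : Fintype.card (Fin (s.card - 1 + 1)) = s.card := by
    rw [Fintype.card_fin, Nat.sub_add_cancel hs.card_pos]
  refine (PMF.toOuterMeasure_uniformOfFintype_apply _).le.trans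
    (le_trans (ENNReal.div_le_div ?_ (Nat.cast_le.2 hcard.ge)) hP)
  rw [Nat.cast_le]
  refine (Fintype.card_le_of_injective (β := {a // a ∈ s.filter fun a => ¬ P a}) (fun r =>
    ⟨(s.equivFin.symm (Fin.cast (Nat.sub_add_cancel hs.card_pos) r.1)).1, ?_⟩) ?_).trans
    (Fintype.card_coe _).le
  · have := r.2
    simp only [Set.mem_preimage, Set.mem_ofPred_eq, and_true] at this
    exact Finset.mem_filter.2 ⟨Subtype.prop _, this⟩
  · intro r r' h
    have h' := Subtype.ext (Subtype.mk.inj h)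
    exact Subtype.ext (Fin.cast_injective _ (s.equivFin.symm.injective h'))

theorem collect [DecidableEq V] [Inhabited α] {f : V → Comp V α} {P : V → α → Prop} {k : ℕ}
    (l : List V) (hf : ∀ v ∈ l, HoldsUpTo Cov 0 (f v) fun a q => P v a ∧ q ≤ k) :
    HoldsUpTo Cov 0 (Comp.collect f l) fun g q => (∀ v ∈ l, P v (g v)) ∧ q ≤ l.length * k := by
  induction l with
  | nil => exact ret (by simp)
  | cons v vs ih =>
    refine bind_zero (hf v (by simp)) fun a q ha => ?_
    refine bind_zero (ih fun u hu => hf u (List.mem_cons_of_mem _ hu)) fun g q' hg => ?_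
    refine ret ⟨fun u hu => ?_, ?_⟩
    · by_cases h : u = v
      · subst h
        simpa using ha.1
      · rw [Function.update_of_ne h]
        exact hg.1 u (by simpa [h] using hu)
    · have := ha.2
      have := hg.2
      rw [List.length_cons, Nat.succ_mul]
      omega

/-- Stopping early only saves queries, since the bounds `κ` are nonnegative; failure probabilities
add. -/
theorem allAccept {ι : Type} {ps : ι → Comp V (Option Bool)} {κ : ι → ℝ} {η : ι → ℝ≥0∞}
    (hκ : ∀ i, 0 ≤ κ i) (l : List ι)
    (h : ∀ i ∈ l, HoldsUpTo Cov (η i) (ps i) fun _ q => (q : ℝ) ≤ κ i) :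
    HoldsUpTo Cov (l.map η).sum (TreeTest.allAccept (l.map ps))
      fun _ q => (q : ℝ) ≤ (l.map κ).sum := by
  induction l with
  | nil => exact ret (by simp)
  | cons i l ih =>
    simp only [List.map_cons, List.sum_cons]
    refine bind (h i (by simp)) fun r q hq => ?_
    have hl : 0 ≤ (l.map κ).sum := List.sum_nonneg fun x hx => by
      obtain ⟨i, _, rfl⟩ := List.mem_map.1 hx
      exact hκ i
    split_ifs
    · refine (ih fun j hj => h j (List.mem_cons_of_mem _ hj)).imp fun _ q' hq' => ?_
      push_cast
      linarith
    · refine ret ?_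
      simpa using by linarith

theorem allAccept_result {ι : Type} {ps : ι → Comp V (Option Bool)} {T : ι → Prop} (l : List ι)
    (h : ∀ i ∈ l, HoldsUpTo Cov 0 (ps i) fun r _ => ∃ b : Bool, r = some b ∧ (b = true ↔ T i)) :
    HoldsUpTo Cov 0 (TreeTest.allAccept (l.map ps))
      fun r _ => ∃ b : Bool, r = some b ∧ (b = true ↔ ∀ i ∈ l, T i) := by
  induction l with
  | nil => exact ret ⟨true, by simp⟩
  | cons i l ih =>
    refine bind_zero (h i (by simp)) fun r q hr => ?_
    obtain ⟨b, rfl, hb⟩ := hr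
    cases b with
    | true =>
      rw [if_pos rfl]
      refine (ih fun j hj => h j (List.mem_cons_of_mem _ hj)).imp fun r _ hr => ?_
      obtain ⟨b, rfl, hb'⟩ := hr
      refine ⟨b, rfl, ?_⟩
      have : T i := hb.1 rfl
      rw [hb', List.forall_mem_cons]
      tauto
    | false =>
      rw [if_neg (by simp)]
      refine ret ⟨false, rfl, ?_⟩
      rw [List.forall_mem_cons]
      have : ¬ T i := fun h => by simpa using hb.2 h
      simp [this]

end HoldsUpTo

/-! ### Connectivity in a graph with one vertex removed -/

section Graph

variable {V : Type} {G : SimpleGraph V} {v i j k : V}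

/-- There is a walk from `i` to `j` that avoids `v`. -/
def ConnAvoid (G : SimpleGraph V) (v i j : V) : Prop :=
  ∃ p : G.Walk i j, v ∉ p.support

namespace ConnAvoid

theorem refl (h : i ≠ v) : ConnAvoid G v i i := ⟨Walk.nil, by simpa using h.symm⟩

theorem symm (h : ConnAvoid G v i j) : ConnAvoid G v j i := by
  obtain ⟨p, hp⟩ := h
  exact ⟨p.reverse, by simpa using hp⟩

theorem trans (h : ConnAvoid G v i j) (h' : ConnAvoid G v j k) : ConnAvoid G v i k := by
  obtain ⟨p, hp⟩ := h
  obtain ⟨q, hq⟩ := h'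
  exact ⟨p.append q, by simp [Walk.mem_support_append_iff, hp, hq]⟩

theorem of_adj (h : G.Adj i j) (hi : i ≠ v) (hj : j ≠ v) : ConnAvoid G v i j :=
  ⟨h.toWalk, by simp [hi.symm, hj.symm]⟩

theorem left_ne (h : ConnAvoid G v i j) : i ≠ v := by
  rintro rfl
  obtain ⟨p, hp⟩ := h
  exact hp p.start_mem_support

theorem right_ne (h : ConnAvoid G v i j) : j ≠ v := h.symm.left_ne

end ConnAvoid

theorem separates_singleton_iff :
    Separates G {v} {i} {j} ↔ ¬ ConnAvoid G v i j := by
  simp [Separates, ConnAvoid]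

/-- A path meets `v` at most once, so one of its two parts at `k` misses `v`. -/
theorem connAvoid_or_connAvoid_of_isPath {p : G.Walk i j} (hp : p.IsPath)
    (hk : k ∈ p.support) (hkv : k ≠ v) : ConnAvoid G v i k ∨ ConnAvoid G v k j := by
  classical
  by_contra! h
  have h1 : v ∈ (p.takeUntil k hk).support := by
    by_contra h'
    exact h.1 ⟨_, h'⟩
  have h2 : v ∈ (p.dropUntil k hk).support := by
    by_contra h'
    exact h.2 ⟨_, h'⟩
  rw [← p.take_spec hk] at hp
  exact hp.ne_of_mem_support_of_append hkv.symm h1 h2 rfl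

theorem isAcyclic_iff_path_length :
    G.IsAcyclic ↔ ∀ x y, G.Adj x y → ∀ p : G.Walk x y, p.IsPath → p.length = 1 := by
  classical
  constructor
  · intro h x y hxy p hp
    have := (h.subsingleton_path x y).elim ⟨p, hp⟩ (Path.singleton hxy)
    rw [Subtype.ext_iff] at this
    simp only [Path.singleton] at this
    simp [this]
  · intro h
    rw [isAcyclic_iff_forall_adj_isBridge]
    intro x y hxy
    rw [isBridge_iff]
    rintro ⟨p⟩
    have hp := p.bypass_isPath
    have h1 := h x y hxy (p.bypass.mapLe (deleteEdges_le _)) (hp.mapLe _)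
    simp only [Walk.length_map, Walk.mapLe] at h1
    have := Walk.adj_of_length_eq_one h1
    simp at this

/-! ### Vertex sets that are closed under simple paths -/

/-- All simple paths between vertices of `B` stay in `B`. -/
def PathClosed (G : SimpleGraph V) (B : Finset V) : Prop :=
  ∀ x ∈ B, ∀ y ∈ B, ∀ p : G.Walk x y, p.IsPath → ∀ z ∈ p.support, z ∈ B

/-- An edge inside `B` is the only simple path between its ends. -/
def CycleFreeOn (G : SimpleGraph V) (B : Finset V) : Prop :=
  ∀ x ∈ B, ∀ y ∈ B, G.Adj x y → ∀ p : G.Walk x y, p.IsPath → p.length = 1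

/-- `C` is a class of the partition of `A` into the vertices of the components of `G` without
`v`. -/
def IsClass (G : SimpleGraph V) (v : V) (A C : Finset V) : Prop :=
  ∃ i ∈ C, ∀ j, j ∈ C ↔ j ∈ A ∧ ConnAvoid G v i j

/-- `Cs` lists the classes of `A` with respect to the components of `G` without `v`. -/
structure IsPartition (G : SimpleGraph V) (v : V) (A : Finset V) (Cs : List (Finset V)) :
    Prop where
  isClass : ∀ C ∈ Cs, IsClass G v A C
  exists_mem : ∀ i ∈ A, ∃ C ∈ Cs, i ∈ C
  disjoint : Cs.Pairwise Disjoint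
  sum_card : (Cs.map Finset.card).sum = A.card

variable {A B C W : Finset V} {Cs : List (Finset V)}

theorem IsClass.nonempty (h : IsClass G v A C) : C.Nonempty := let ⟨i, hi, _⟩ := h; ⟨i, hi⟩

theorem IsClass.subset (h : IsClass G v A C) : C ⊆ A := by
  obtain ⟨i, hi, h⟩ := h
  exact fun j hj => ((h j).1 hj).1

theorem IsClass.connAvoid (h : IsClass G v A C) (hi : i ∈ C) (hj : j ∈ C) :
    ConnAvoid G v i j := by
  obtain ⟨k, hk, h⟩ := h
  exact ((h i).1 hi).2.symm.trans ((h j).1 hj).2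

theorem IsClass.mem (h : IsClass G v A C) (hi : i ∈ C) (hj : j ∈ A) (hij : ConnAvoid G v i j) :
    j ∈ C := by
  obtain ⟨k, hk, h⟩ := h
  exact (h j).2 ⟨hj, ((h i).1 hi).2.trans hij⟩

theorem IsPartition.length_le_card (h : IsPartition G v A Cs) : Cs.length ≤ A.card := by
  rw [← h.sum_card, ← Cs.length_map (f := Finset.card)]
  refine List.length_le_sum_of_one_le _ fun k hk => ?_
  obtain ⟨C, hC, rfl⟩ := List.mem_map.1 hk
  exact (h.isClass C hC).nonempty.card_pos

/-- As `G` is connected, each component of `G - v` contains a neighbour of `v`, and distinct classes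
lie in distinct components. -/
theorem IsPartition.length_le_degree [Fintype V] [DecidableRel G.Adj] (hG : G.Connected)
    (h : IsPartition G v A Cs) : Cs.length ≤ G.degree v := by
  classical
  have hex : ∀ C ∈ Cs, ∃ u, G.Adj v u ∧ ∀ i ∈ C, ConnAvoid G v i u := by
    intro C hC
    obtain ⟨i, hi⟩ := (h.isClass C hC).nonempty
    have hiv : i ≠ v := ((h.isClass C hC).connAvoid hi hi).left_ne
    obtain ⟨p, hp⟩ := (hG.preconnected v i).exists_isPath
    cases p with
    | nil => exact absurd rfl hiv
    | cons hvu q =>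
      rename_i u
      rw [Walk.cons_isPath_iff] at hp
      exact ⟨u, hvu, fun j hj => ((h.isClass C hC).connAvoid hj hi).trans (ConnAvoid.symm ⟨q, hp.2⟩)⟩
  have : Nonempty V := ⟨v⟩
  choose! g hg using hex
  have hnodup : Cs.Nodup := h.disjoint.imp_of_mem fun {C D} hC _ hCD hEq => by
    subst hEq
    exact (h.isClass C hC).nonempty.ne_empty ((Finset.disjoint_self_iff_empty _).1 hCD)
  rw [← List.toFinset_card_of_nodup hnodup, ← G.card_neighborFinset_eq_degree]
  refine Finset.card_le_card_of_injOn g (fun C hC => ?_) ?_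
  · simpa using (hg C (by simpa using hC)).1
  · intro C hC D hD hCD
    simp only [List.coe_toFinset, Set.mem_ofPred_eq] at hC hD
    obtain ⟨i, hi⟩ := (h.isClass C hC).nonempty
    obtain ⟨j, hj⟩ := (h.isClass D hD).nonempty
    have hij : ConnAvoid G v i j :=
      ((hg C hC).2 i hi).trans (hCD ▸ ((hg D hD).2 j hj).symm)
    ext k
    constructor
    · intro hk
      exact (h.isClass D hD).mem hj ((h.isClass C hC).subset hk)
        (hij.symm.trans ((h.isClass C hC).connAvoid hi hk))
    · intro hk
      exact (h.isClass C hC).mem hi ((h.isClass D hD).subset hk)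
        (hij.trans ((h.isClass D hD).connAvoid hj hk))

/-- Any vertex other than `v` on a path is joined, avoiding `v`, to one of its ends; that end is
then not `v`, so it lies in `C`. -/
theorem PathClosed.insert_isClass [DecidableEq V] (hB : PathClosed G B) (hv : v ∈ B)
    (hC : IsClass G v (B.erase v) C) : PathClosed G (insert v C) := by
  have hsub : insert v C ⊆ B := Finset.insert_subset hv (hC.subset.trans (Finset.erase_subset _ _))
  intro x hx y hy p hp z hz
  have hzB := hB x (hsub hx) y (hsub hy) p hp z hz
  by_cases hzv : z = v
  · exact hzv ▸ Finset.mem_insert_self _ _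
  refine Finset.mem_insert_of_mem ?_
  rcases connAvoid_or_connAvoid_of_isPath hp hz hzv with h | h
  · exact hC.mem (Finset.mem_of_mem_insert_of_ne hx h.left_ne)
      (Finset.mem_erase.2 ⟨hzv, hzB⟩) h
  · exact hC.mem (Finset.mem_of_mem_insert_of_ne hy h.right_ne)
      (Finset.mem_erase.2 ⟨hzv, hzB⟩) h.symm

/-- No edge joins two different classes, so each edge inside `B` lies in a single piece. -/
theorem cycleFreeOn_iff_forall_isPartition [DecidableEq V] (hv : v ∈ B)
    (hCs : IsPartition G v (B.erase v) Cs) :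
    CycleFreeOn G B ↔ ∀ C ∈ Cs, CycleFreeOn G (insert v C) := by
  constructor
  · intro h C hC x hx y hy
    have hsub : insert v C ⊆ B :=
      Finset.insert_subset hv ((hCs.isClass C hC).subset.trans (Finset.erase_subset _ _))
    exact h x (hsub hx) y (hsub hy)
  · intro h x hx y hy hxy
    by_cases hxv : x = v
    · subst hxv
      obtain ⟨C, hC, hyC⟩ := hCs.exists_mem y (Finset.mem_erase.2 ⟨hxy.ne.symm, hy⟩)
      exact h C hC x (Finset.mem_insert_self _ _) y (Finset.mem_insert_of_mem hyC) hxy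
    · obtain ⟨C, hC, hxC⟩ := hCs.exists_mem x (Finset.mem_erase.2 ⟨hxv, hx⟩)
      refine h C hC x (Finset.mem_insert_of_mem hxC) y ?_ hxy
      by_cases hyv : y = v
      · exact hyv ▸ Finset.mem_insert_self _ _
      · exact Finset.mem_insert_of_mem ((hCs.isClass C hC).mem hxC
          (Finset.mem_erase.2 ⟨hyv, hy⟩) (ConnAvoid.of_adj hxy hxv hyv))

open Classical in
-- Keep stepping from `v` to its neighbour `u` inside the heavy branch. The walk can neither turn
-- back nor continue forever, as the current branch strictly shrinks.
theorem not_forall_heavy (hG : G.Connected) (hB : PathClosed G B) (hc : CycleFreeOn G B)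
    (hW : W ⊆ B)
    (heavy : ∀ v ∈ B, ∃ i ∈ W, ConnAvoid G v i i ∧ W.card < 2 * (W.filter (ConnAvoid G v i)).card)
    (N : ℕ) (v i : V) (hv : v ∈ B) (hi : i ∈ W) (hiv : ConnAvoid G v i i)
    (hlt : W.card < 2 * (W.filter (ConnAvoid G v i)).card)
    (hN : (B.filter (ConnAvoid G v i)).card = N) : False := by
  induction N using Nat.strong_induction_on generalizing v i with
  | _ N ih =>
    obtain ⟨p, hp⟩ := (hG.preconnected v i).exists_isPath
    cases p with
    | nil => exact hiv.left_ne rfl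
    | cons hvu q =>
      rename_i u
      have hu : u ∈ B := hB v hv i (hW hi) _ hp u (by simp)
      rw [Walk.cons_isPath_iff] at hp
      have hiu : ConnAvoid G v i u := ConnAvoid.symm ⟨q, hp.2⟩
      obtain ⟨j, hj, hju, hlt'⟩ := heavy u hu
      -- If the heavy branch at `u` contains `v`, the two branches are disjoint: a common vertex
      -- would give a path from `u` to `v` that does not use the edge `uv`. Two disjoint sets cannot
      -- both hold more than half of `W`.
      by_cases hjv : ConnAvoid G u j v
      · have hdisj : Disjoint (W.filter (ConnAvoid G v i)) (W.filter (ConnAvoid G u j)) := by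
          rw [Finset.disjoint_left]
          intro x hx hx'
          obtain ⟨a, ha⟩ := hiu.symm.trans (Finset.mem_filter.1 hx).2
          obtain ⟨b, hb⟩ := (Finset.mem_filter.1 hx').2.symm.trans hjv
          have hlen := hc u hu v hv hvu.symm _ (a.append b).bypass_isPath
          have hmem : s(u, v) ∈ (a.append b).bypass.edges := by
            generalize (a.append b).bypass = w at hlen
            cases w with
            | nil => simp at hlen
            | cons h w' =>
              cases w' with
              | nil => simp
              | cons h' w'' => simp at hlen
          have := Walk.edges_bypass_subset_edges _ hmem
          rw [Walk.edges_append, List.mem_append] at this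
          rcases this with h | h
          · exact ha (Walk.snd_mem_support_of_mem_edges _ h)
          · exact hb (Walk.fst_mem_support_of_mem_edges _ h)
        have := Finset.card_le_card (Finset.union_subset
          (Finset.filter_subset (ConnAvoid G v i) W) (Finset.filter_subset (ConnAvoid G u j) W))
        rw [Finset.card_union_of_disjoint hdisj] at this
        omega
      -- Otherwise the branch at `u` lies in the branch at `v` and misses `u`. The induction counts
      -- vertices in `B` because `u` need not be in `W`.
      · refine ih _ ?_ u j hu hj hju hlt' rfl
        rw [← hN]
        refine Finset.card_lt_card (Finset.ssubset_iff_of_subset ?_ |>.2 ⟨u, ?_, ?_⟩)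
        · intro x hx
          rw [Finset.mem_filter] at hx ⊢
          refine ⟨hx.1, hiu.trans ?_⟩
          obtain ⟨w, hw⟩ := (hG.preconnected u x).exists_isPath
          by_contra hux
          have hvw : v ∈ w.support := by
            by_contra h
            exact hux ⟨w, h⟩
          rcases connAvoid_or_connAvoid_of_isPath (v := u) hw hvw hvu.ne with h | h
          · exact h.left_ne rfl
          · exact hjv (hx.2.trans h.symm)
        · exact Finset.mem_filter.2 ⟨hu, hiu⟩
        · intro h
          exact (Finset.mem_filter.1 h).2.right_ne rfl

/-- A tree has a centroid with respect to the weight that counts the vertices in `W`. -/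
theorem exists_centroid [DecidableEq V] (hG : G.Connected) (hB : PathClosed G B)
    (hc : CycleFreeOn G B) (hne : B.Nonempty) (hW : W ⊆ B) :
    ∃ v ∈ B, ∀ C, IsClass G v (W.erase v) C → 2 * C.card ≤ W.card := by
  classical
  by_contra! h
  have heavy : ∀ v ∈ B, ∃ i ∈ W, ConnAvoid G v i i ∧
      W.card < 2 * (W.filter (ConnAvoid G v i)).card := by
    intro v hv
    obtain ⟨C, ⟨i, hi, hC⟩, hlt⟩ := h v hv
    have hii := (hC i).1 hi
    refine ⟨i, Finset.mem_of_mem_erase hii.1, hii.2, hlt.trans_le ?_⟩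
    refine Nat.mul_le_mul_left _ (Finset.card_le_card fun j hj => ?_)
    have := (hC j).1 hj
    exact Finset.mem_filter.2 ⟨Finset.mem_of_mem_erase this.1, this.2⟩
  obtain ⟨v, hv⟩ := hne
  obtain ⟨i, hi, hii, hlt⟩ := heavy v hv
  exact not_forall_heavy hG hB hc hW heavy _ v i hv hi hii hlt rfl

end Graph

/-! ### Zero patterns of inverse matrices -/

section Matrices

variable {V : Type} [Fintype V] [DecidableEq V] {M N : Matrix V V ℝ}

/-- The inverse of a block diagonal matrix is block diagonal: column `j` of `N`, cut down to `D`, is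
killed by `M`. -/
theorem apply_eq_zero_of_block (hMN : M * N = 1) (D : V → Prop)
    (hD : ∀ r c, D r → ¬ D c → M r c = 0 ∧ M c r = 0) {i j : V} (hi : D i) (hj : ¬ D j) :
    N i j = 0 := by
  classical
  let y : V → ℝ := fun c => if D c then N c j else 0
  have hMy : M.mulVec y = 0 := by
    funext r
    rw [Matrix.mulVec, dotProduct, Pi.zero_apply]
    by_cases hr : D r
    · have h1 : (M * N) r j = 0 := by
        rw [hMN, Matrix.one_apply_ne]
        rintro rfl
        exact hj hr
      rw [← h1, Matrix.mul_apply]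
      refine Finset.sum_congr rfl fun c _ => ?_
      by_cases hc : D c
      · simp [y, hc]
      · simp [y, hc, (hD r c hr hc).1]
    · refine Finset.sum_eq_zero fun c _ => ?_
      by_cases hc : D c
      · simp [(hD c r hc hr).2]
      · simp [y, hc]
  have hy : y = 0 := by
    rw [← Matrix.one_mulVec y, ← mul_eq_one_comm.1 hMN, ← Matrix.mulVec_mulVec, hMy,
      Matrix.mulVec_zero]
  simpa [y, hi] using congrFun hy i

/-- Global Markov property at a cut vertex `v` of the sparsity graph of `M`. Cut column `j` of the
conditional matrix down to `D`: its image under `M` is supported at `v`, so it is a multiple of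
column `v` of `N`. It vanishes at `v` while `N v v ≠ 0`, hence it is zero. -/
theorem apply_eq_of_block_of_notMem (hMN : M * N = 1) (D : V → Prop) {v : V} (hv : ¬ D v)
    (hN : N v v ≠ 0) (hD : ∀ r c, D r → ¬ D c → c ≠ v → M r c = 0 ∧ M c r = 0)
    {i j : V} (hi : D i) (hj : ¬ D j) : N i j - N i v * N v j / N v v = 0 := by
  classical
  let x : V → ℝ := fun c => N c j - N c v * (N v j / N v v)
  let y : V → ℝ := fun c => if D c then x c else 0
  have hxv : x v = 0 := by simp only [x]; field_simp; ring
  have hMy : ∀ r, r ≠ v → M.mulVec y r = 0 := by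
    intro r hrv
    rw [Matrix.mulVec, dotProduct]
    by_cases hr : D r
    · have h1 : (M * N) r j - (M * N) r v * (N v j / N v v) = 0 := by
        rw [hMN, Matrix.one_apply_ne, Matrix.one_apply_ne hrv, zero_mul, sub_zero]
        rintro rfl
        exact hj hr
      rw [← h1, Matrix.mul_apply, Matrix.mul_apply, Finset.sum_mul, ← Finset.sum_sub_distrib]
      refine Finset.sum_congr rfl fun c _ => ?_
      have h2 : M r c * N c j - M r c * N c v * (N v j / N v v) = M r c * x c := by
        simp only [x]; ring
      rw [h2]
      by_cases hc : D c
      · simp [y, hc]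
      · by_cases hcv : c = v
        · subst hcv
          simp [y, hc, hxv]
        · simp [y, hc, (hD r c hr hc hcv).1]
    · refine Finset.sum_eq_zero fun c _ => ?_
      by_cases hc : D c
      · simp [(hD c r hc hr hrv).2]
      · simp [y, hc]
  have hy : ∀ c, y c = N c v * M.mulVec y v := by
    intro c
    conv_lhs => rw [← Matrix.one_mulVec y, ← mul_eq_one_comm.1 hMN, ← Matrix.mulVec_mulVec]
    rw [Matrix.mulVec, dotProduct, Finset.sum_eq_single v]
    · intro r _ hr
      rw [hMy r hr, mul_zero]
    · simp
  have hs : M.mulVec y v = 0 := by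
    have := hy v
    simp only [y, if_neg hv] at this
    exact (mul_eq_zero.1 this.symm).resolve_left hN
  have := hy i
  rw [hs, mul_zero] at this
  simp only [y, if_pos hi, x] at this
  rw [← this]
  ring

end Matrices

/-! ### Faithful matrices and the direct test -/

section Submatrices

variable {V : Type} {G : SimpleGraph V} {Cov : Matrix V V ℝ} {B : Finset V}

theorem exists_walk_of_adj {H : SimpleGraph B} (hH : ∀ x y : B, G.Adj x.1 y.1 → H.Adj x y) {x y : V}
    (p : G.Walk x y) (hp : ∀ z ∈ p.support, z ∈ B) (hx : x ∈ B) (hy : y ∈ B) :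
    ∃ q : H.Walk ⟨x, hx⟩ ⟨y, hy⟩, q.support.map Subtype.val = p.support := by
  induction p with
  | nil => exact ⟨Walk.nil, rfl⟩
  | cons hxu p ih =>
    rename_i x u y
    have hu : u ∈ B := hp u (by simp)
    obtain ⟨q, hq⟩ := ih (fun z hz => hp z (by simp [hz])) hu hy
    exact ⟨Walk.cons (hH ⟨x, hx⟩ ⟨u, hu⟩ hxu) q, by simp [hq]⟩

variable [DecidableEq V]

/-- The conditional entry is the Schur complement of `Cov v v` in a 2 × 2 minor. If it vanishes, the
submatrix is an outer product. Repeated-index selection also covers `i = j`. -/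
theorem rank_submatrix_pair_eq_one_iff {v i j : V} (hv : Cov v v ≠ 0) (hi : i ≠ v) (hj : j ≠ v) :
    (Cov.submatrix (fun a : ↥(({i} : Finset V) ∪ {v}) => (a : V))
        (fun b : ↥(({j} : Finset V) ∪ {v}) => (b : V))).rank = 1 ↔
      Cov i j - Cov i v * Cov v j / Cov v v = 0 := by
  set S := Cov.submatrix (fun a : ↥(({i} : Finset V) ∪ {v}) => (a : V))
        (fun b : ↥(({j} : Finset V) ∪ {v}) => (b : V)) with hS
  have hii : i ∈ ({i} : Finset V) ∪ {v} := by simp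
  have hiv : v ∈ ({i} : Finset V) ∪ {v} := by simp
  have hjj : j ∈ ({j} : Finset V) ∪ {v} := by simp
  have hjv : v ∈ ({j} : Finset V) ∪ {v} := by simp
  constructor
  · intro hr
    by_contra hne
    have hle := S.rank_submatrix_le ![⟨i, hii⟩, ⟨v, hiv⟩] ![⟨j, hjj⟩, ⟨v, hjv⟩]
    rw [Matrix.rank_of_isUnit, hr, Fintype.card_fin] at hle
    · omega
    · rw [Matrix.isUnit_iff_isUnit_det, Matrix.det_fin_two, isUnit_iff_ne_zero]
      simp only [hS, Matrix.submatrix_apply, Matrix.cons_val_zero, Matrix.cons_val_one]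
      intro h0
      apply hne
      field_simp
      linarith
  · intro h0
    apply le_antisymm
    · have : S = Matrix.vecMulVec (fun a => Cov a.1 v) (fun b => Cov v b.1 / Cov v v) := by
        ext ⟨a, ha⟩ ⟨b, hb⟩
        simp only [Finset.mem_union, Finset.mem_singleton] at ha hb
        simp only [hS, Matrix.submatrix_apply, Matrix.vecMulVec_apply]
        rcases ha with rfl | rfl <;> rcases hb with rfl | rfl
        · rw [sub_eq_zero] at h0
          rw [h0, mul_div_assoc]
        all_goals field_simp
      rw [this]
      exact Matrix.rank_vecMulVec_le _ _
    · have hle := S.rank_submatrix_le ![⟨v, hiv⟩] ![⟨v, hjv⟩]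
      rwa [Matrix.rank_of_isUnit, Fintype.card_fin] at hle
      rw [Matrix.isUnit_iff_isUnit_det, Matrix.det_fin_one, isUnit_iff_ne_zero]
      simpa [hS] using hv

/-- The graph on `B` given by the off-diagonal support of the inverse of the principal submatrix
indexed by `B`. -/
def inverseGraph (Cov : Matrix V V ℝ) (B : Finset V) : SimpleGraph B :=
  SimpleGraph.fromRel fun i j : B => (Matrix.of fun i j : B => Cov i.1 j.1)⁻¹ i j ≠ 0

theorem inv_of_eq_zero_of_not_adj {i j : B} (hne : i ≠ j) (hij : ¬ (inverseGraph Cov B).Adj i j) :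
    (Matrix.of fun i j : B => Cov i.1 j.1)⁻¹ i j = 0 ∧
      (Matrix.of fun i j : B => Cov i.1 j.1)⁻¹ j i = 0 := by
  rw [inverseGraph, fromRel_adj] at hij
  simpa [hne] using hij

end Submatrices

section Faithful

variable {V : Type} [Fintype V] [DecidableEq V] {G : SimpleGraph V} {Cov : Matrix V V ℝ}

theorem apply_ne_zero_of_faithful (hG : G.Connected) (h : Cov ∈ faithfulModel 1 G) (i j : V) :
    Cov i j ≠ 0 := by
  intro hij
  obtain ⟨p⟩ := hG.preconnected i j
  have hrank := (h.2 {i} {j} ∅ (by simp)).1 (by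
    have : Cov.submatrix (fun a : ↥(({i} : Finset V) ∪ ∅) => (a : V))
        (fun b : ↥(({j} : Finset V) ∪ ∅) => (b : V)) = 0 := by
      ext ⟨a, ha⟩ ⟨b, hb⟩
      simp only [Finset.union_empty, Finset.mem_singleton] at ha hb
      subst ha hb
      simpa using hij
    rw [this, Matrix.rank_zero, Finset.card_empty])
  obtain ⟨s, hs, _⟩ := hrank i (by simp) j (by simp) p
  simp at hs

theorem condEntry_ne_zero_iff_of_faithful (h : Cov ∈ faithfulModel 1 G) {v i j : V} (hi : i ≠ v)
    (hj : j ≠ v) : Cov i j - Cov i v * Cov v j / Cov v v ≠ 0 ↔ ConnAvoid G v i j := by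
  have hv : Cov v v ≠ 0 := h.1.1.diag_pos.ne'
  rw [not_iff_comm, ← separates_singleton_iff, ← h.2 {i} {j} {v} (by simp),
    ← rank_submatrix_pair_eq_one_iff hv hi hj, Finset.card_singleton]

theorem of_mul_inv_eq_one (h : Cov ∈ model G) (B : Finset V) :
    (Matrix.of fun i j : B => Cov i.1 j.1)⁻¹ * (Matrix.of fun i j : B => Cov i.1 j.1) = 1 := by
  have hpd : (Matrix.of fun i j : B => Cov i.1 j.1).PosDef :=
    h.1.submatrix (e := fun i : B => i.1) Subtype.val_injective
  exact Matrix.nonsing_inv_mul _ ((Matrix.isUnit_iff_isUnit_det _).1 hpd.isUnit)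

variable {B : Finset V}

/-- In a path-closed set, marginalization does not change the off-diagonal precisions. -/
theorem inv_of_apply (h : Cov ∈ faithfulModel 1 G) (hB : PathClosed G B) {i b : B} (hib : i ≠ b) :
    (Matrix.of fun i j : B => Cov i.1 j.1)⁻¹ i b = Cov⁻¹ i.1 b.1 := by
  set S : Matrix B B ℝ := Matrix.of fun i j : B => Cov i.1 j.1 with hS
  have hSinv : S⁻¹ * S = 1 := of_mul_inv_eq_one h.1 B
  have hinv : Cov⁻¹ * Cov = 1 :=
    Matrix.nonsing_inv_mul _ ((Matrix.isUnit_iff_isUnit_det _).1 h.1.1.isUnit)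
  have hii : Cov i.1 i.1 ≠ 0 := h.1.1.diag_pos.ne'
  -- A neighbour `u` of `i` outside `B` cannot reach `b` while avoiding `i`, since the resulting
  -- path from `i` to `b` would leave `B`. So `i` separates `u` from `b`, and column `u` contributes
  -- a multiple of row `i` of `Cov`.
  have hout : ∀ u ∉ B, ∀ b : B,
      Cov⁻¹ i.1 u * Cov u b.1 = Cov⁻¹ i.1 u * Cov u i.1 / Cov i.1 i.1 * Cov i.1 b.1 := by
    intro u hu b
    have hui : u ≠ i.1 := fun h => hu (h ▸ i.2)
    by_cases hadj : G.Adj i.1 u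
    · by_cases hbi : b = i
      · subst hbi
        field_simp
      · have hbi' : b.1 ≠ i.1 := fun h => hbi (Subtype.ext h)
        have hsep : ¬ ConnAvoid G i.1 u b.1 := by
          rintro ⟨w, hw⟩
          have hpath : (Walk.cons hadj w.bypass).IsPath :=
            Walk.cons_isPath_iff _ _ |>.2
              ⟨w.bypass_isPath, fun h => hw (w.support_bypass_subset_support h)⟩
          exact hu (hB i.1 i.2 b.1 b.2 _ hpath u (by simp))
        rw [← condEntry_ne_zero_iff_of_faithful h hui hbi', not_not, sub_eq_zero] at hsep
        rw [hsep]
        ring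
    · rw [h.1.2 i.1 u hui.symm hadj]
      simp
  -- All outside contributions merge into a correction of the diagonal entry at `i` alone.
  set t := ∑ u ∈ Bᶜ, Cov⁻¹ i.1 u * Cov u i.1 / Cov i.1 i.1 with ht
  have hrow : Matrix.vecMul (fun c : B => Cov⁻¹ i.1 c.1 + if c = i then t else 0) S =
      Pi.single i 1 := by
    funext b
    have h1 : (Cov⁻¹ * Cov) i.1 b.1 = (Pi.single i 1 : B → ℝ) b := by
      rw [hinv, Matrix.one_apply, Pi.single_apply]
      simp only [eq_comm, Subtype.ext_iff]
    rw [← h1, Matrix.mul_apply, ← Finset.sum_add_sum_compl B, Matrix.vecMul, dotProduct]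
    simp only [add_mul, Finset.sum_add_distrib, ite_mul, zero_mul, Finset.sum_ite_eq',
      Finset.mem_univ, if_true, hS, Matrix.of_apply]
    congr 1
    · exact Finset.sum_coe_sort B fun c => Cov⁻¹ i.1 c * Cov c b.1
    · rw [ht, Finset.sum_mul]
      refine Finset.sum_congr rfl fun u hu => ?_
      rw [hout u (Finset.mem_compl.1 hu) b]
  have hx : (fun c : B => Cov⁻¹ i.1 c.1 + if c = i then t else 0) = S⁻¹ i := by
    have := congrArg (fun y => Matrix.vecMul y S⁻¹) hrow
    simp only [Matrix.vecMul_vecMul, mul_eq_one_comm.1 hSinv, Matrix.vecMul_one,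
      Matrix.single_one_vecMul] at this
    exact this
  rw [← congrFun hx b, if_neg hib.symm, add_zero]

theorem inverseGraph_adj_imp (h : Cov ∈ faithfulModel 1 G) (hB : PathClosed G B) {i j : B}
    (hij : (inverseGraph Cov B).Adj i j) : G.Adj i.1 j.1 := by
  rw [inverseGraph, fromRel_adj] at hij
  by_contra hadj
  rw [inv_of_apply h hB hij.1, inv_of_apply h hB hij.1.symm] at hij
  have hne : i.1 ≠ j.1 := fun h => hij.1 (Subtype.ext h)
  rcases hij.2 with h' | h'
  · exact h' (h.1.2 _ _ hne hadj)
  · exact h' (h.1.2 _ _ hne.symm fun h => hadj h.symm)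

/-- A disconnected inverse graph would make the submatrix block diagonal, but `Cov` has no zero
entry. -/
theorem inverseGraph_connected (hG : G.Connected) (h : Cov ∈ faithfulModel 1 G)
    (hne : B.Nonempty) : (inverseGraph Cov B).Connected := by
  have : Nonempty B := hne.to_subtype
  refine ⟨fun i j => ?_⟩
  by_contra hij
  refine apply_ne_zero_of_faithful hG h i.1 j.1
    (apply_eq_zero_of_block (of_mul_inv_eq_one h.1 B) ((inverseGraph Cov B).Reachable i)
      (fun r c hr hc => ?_) (Reachable.refl i) hij)
  refine inv_of_eq_zero_of_not_adj ?_ fun hadj => hc (hr.trans hadj.reachable)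
  rintro rfl
  exact hc hr

/-- If the tree missed the edge `xy`, the second vertex `v` of its path from `x` to `y` would
separate them in the tree and force a zero conditional entry given `v`. The edge itself avoids `v`,
so faithfulness forbids this. -/
theorem adj_inverseGraph_of_isTree (h : Cov ∈ faithfulModel 1 G)
    (hT : (inverseGraph Cov B).IsTree) {x y : B} (hxy : G.Adj x.1 y.1) :
    (inverseGraph Cov B).Adj x y := by
  by_contra hadj
  have hne : x ≠ y := fun h => hxy.ne (congrArg _ h)
  obtain ⟨p, hp⟩ := (hT.1.preconnected x y).exists_isPath
  have huniq := hT.2.subsingleton_path x y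
  cases p with
  | nil => exact hne rfl
  | cons hxv q =>
    rename_i v
    have hvy : v ≠ y := by
      rintro rfl
      exact hadj hxv
    have hD : ¬ ConnAvoid (inverseGraph Cov B) v x y := by
      rintro ⟨w, hw⟩
      have := huniq.elim ⟨_, hp⟩ ⟨_, w.bypass_isPath⟩
      rw [Subtype.mk.injEq] at this
      refine hw (w.support_bypass_subset_support ?_)
      rw [← this]
      simp
    have hzero := apply_eq_of_block_of_notMem (of_mul_inv_eq_one h.1 B)
      (ConnAvoid (inverseGraph Cov B) v x) (fun h => h.right_ne rfl)
      (by simpa using h.1.1.diag_pos.ne')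
      (fun r c hr hc hcv => inv_of_eq_zero_of_not_adj (fun hrc => hc (hrc ▸ hr))
        fun hrc => hc (hr.trans (ConnAvoid.of_adj hrc hr.right_ne hcv)))
      (ConnAvoid.refl hxv.ne) hD
    have hxv' : x.1 ≠ v.1 := fun h => hxv.ne (Subtype.ext h)
    have hyv' : y.1 ≠ v.1 := fun h => hvy (Subtype.ext h.symm)
    exact (condEntry_ne_zero_iff_of_faithful h hxv' hyv').2 (ConnAvoid.of_adj hxy hxv' hyv') hzero

theorem inverseGraph_isTree_iff (hG : G.Connected) (h : Cov ∈ faithfulModel 1 G)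
    (hB : PathClosed G B) (hne : B.Nonempty) :
    (inverseGraph Cov B).IsTree ↔ CycleFreeOn G B := by
  constructor
  · intro hT x hx y hy hxy p hp
    have hH : ∀ x y : B, G.Adj x.1 y.1 → (inverseGraph Cov B).Adj x y :=
      fun x y => adj_inverseGraph_of_isTree h hT
    obtain ⟨q, hq⟩ := exists_walk_of_adj hH p (hB x hx y hy p hp) hx hy
    have hqp : q.IsPath := by
      rw [Walk.isPath_def] at hp ⊢
      rw [← hq] at hp
      exact hp.of_map
    have hlen := isAcyclic_iff_path_length.1 hT.2 _ _ (hH ⟨x, hx⟩ ⟨y, hy⟩ hxy) q hqp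
    have hsupp := congrArg List.length hq
    rw [List.length_map, Walk.length_support, Walk.length_support] at hsupp
    omega
  · intro hc
    refine ⟨inverseGraph_connected hG h hne, isAcyclic_iff_path_length.2 fun x y hxy p hp => ?_⟩
    let f : inverseGraph Cov B →g G := ⟨Subtype.val, inverseGraph_adj_imp h hB⟩
    have hf : Function.Injective f := Subtype.val_injective
    have := hc x.1 x.2 y.1 y.2 (inverseGraph_adj_imp h hB hxy) (p.map f)
      (hp.map hf)
    simpa using this

end Faithful

/-! ### Samples that represent the large classes -/

section Sampling

variable {V : Type} [DecidableEq V]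

/-- Factor by factor in the falling factorials: `(u - i) * a ≤ N - i`. -/
theorem choose_mul_pow_le_choose {u N : ℕ} (a k : ℕ) (ha : 1 ≤ a) (h : a * u ≤ N) :
    u.choose k * a ^ k ≤ N.choose k := by
  have hdesc : u.descFactorial k * a ^ k ≤ N.descFactorial k := by
    induction k with
    | zero => simp
    | succ k ih =>
      rw [Nat.descFactorial_succ, Nat.descFactorial_succ, pow_succ]
      have h1 : (u - k) * a ≤ N - k := by
        rw [Nat.sub_mul, mul_comm u a]
        have : k ≤ k * a := Nat.le_mul_of_pos_right k ha
        omega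
      calc (u - k) * u.descFactorial k * (a ^ k * a)
          = ((u - k) * a) * (u.descFactorial k * a ^ k) := by ring
        _ ≤ _ := Nat.mul_le_mul h1 ih
  rw [Nat.descFactorial_eq_factorial_mul_choose, Nat.descFactorial_eq_factorial_mul_choose,
    mul_assoc] at hdesc
  exact Nat.le_of_mul_le_mul_left hdesc (Nat.factorial_pos k)

theorem card_filter_superset_le (B T : Finset V) (m : ℕ) :
    ((B.powersetCard m).filter (T ⊆ ·)).card ≤ (B.card - T.card).choose (m - T.card) := by
  by_cases hT : T ⊆ B
  · rw [← Finset.card_sdiff_of_subset hT, ← Finset.card_powersetCard]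
    refine (Finset.card_le_card ?_).trans (Finset.card_image_le (f := (· ∪ T)))
    intro W hW
    rw [Finset.mem_filter, Finset.mem_powersetCard] at hW
    rw [Finset.mem_image]
    refine ⟨W \ T, Finset.mem_powersetCard.2 ⟨Finset.sdiff_subset_sdiff hW.1.1 le_rfl, ?_⟩,
      Finset.sdiff_union_of_subset hW.2⟩
    rw [Finset.card_sdiff_of_subset hW.2, hW.1.2]
  · rw [Finset.filter_false_of_mem, Finset.card_empty]
    · exact Nat.zero_le _
    · intro W hW hTW
      exact hT (hTW.trans (Finset.mem_powersetCard.1 hW).1)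

/-- Few `m`-element subsets of `B` have half of their elements in a small set `U`. -/
theorem card_filter_inter_mul_pow_le {B U : Finset V} {m k : ℕ} (hmk : m ≤ 2 * k) (hkm : k ≤ m)
    (hU : 8 * U.card ≤ B.card) :
    ((B.powersetCard m).filter (fun W => k ≤ (W ∩ U).card)).card * 2 ^ k ≤ B.card.choose m := by
  have hsub : (B.powersetCard m).filter (fun W => k ≤ (W ∩ U).card) ⊆
      (U.powersetCard k).biUnion fun T => (B.powersetCard m).filter (T ⊆ ·) := by
    intro W hW
    rw [Finset.mem_filter] at hW
    obtain ⟨T, hT, hTk⟩ := Finset.exists_subset_card_eq hW.2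
    rw [Finset.mem_biUnion]
    exact ⟨T, Finset.mem_powersetCard.2 ⟨hT.trans Finset.inter_subset_right, hTk⟩,
      Finset.mem_filter.2 ⟨hW.1, hT.trans Finset.inter_subset_left⟩⟩
  have hcount : ((B.powersetCard m).filter (fun W => k ≤ (W ∩ U).card)).card ≤
      U.card.choose k * (B.card - k).choose (m - k) := by
    refine (Finset.card_le_card hsub).trans
      ((Finset.card_biUnion_le_card_mul _ _ _ fun T hT => ?_).trans_eq
        (by rw [Finset.card_powersetCard]))
    have := card_filter_superset_le B T m
    rwa [(Finset.mem_powersetCard.1 hT).2] at this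
  have hmul : B.card.choose m * m.choose k = B.card.choose k * (B.card - k).choose (m - k) :=
    Nat.choose_mul hkm
  have h4 : m.choose k ≤ 4 ^ k :=
    (Nat.choose_le_two_pow m k).trans
      ((Nat.pow_le_pow_right (by norm_num) hmk).trans_eq (by rw [pow_mul]; norm_num))
  -- The union bound over `k`-subsets of `U` gives a fraction `C(|U|,k) C(m,k) / C(|B|,k)`, at most
  -- `8⁻ᵏ · 4ᵏ = 2⁻ᵏ`.
  refine Nat.le_of_mul_le_mul_right (c := 4 ^ k) ?_ (by positivity)
  calc _ * 2 ^ k * 4 ^ k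
      ≤ U.card.choose k * (B.card - k).choose (m - k) * 2 ^ k * 4 ^ k := by gcongr
    _ = U.card.choose k * 8 ^ k * (B.card - k).choose (m - k) := by
        rw [show (8 : ℕ) = 2 * 4 by norm_num, mul_pow]; ring
    _ ≤ B.card.choose k * (B.card - k).choose (m - k) := by
        gcongr
        exact choose_mul_pow_le_choose 8 k (by norm_num) hU
    _ = B.card.choose m * m.choose k := hmul.symm
    _ ≤ B.card.choose m * 4 ^ k := by gcongr

/-- Every class that contains seven eighths of `B` contains the majority of the sample `W`. -/
def Representative (G : SimpleGraph V) (B W : Finset V) : Prop :=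
  ∀ v ∈ B, ∀ C, IsClass G v (B.erase v) C → 2 * (W ∩ C).card ≤ W.card → B.card < 8 * (B \ C).card

theorem IsClass.eq_of_card_lt {G : SimpleGraph V} {v : V} {B C D : Finset V}
    (hC : IsClass G v (B.erase v) C) (hD : IsClass G v (B.erase v) D)
    (h : B.card < C.card + D.card) : C = D := by
  have hCB := hC.subset.trans (Finset.erase_subset _ _)
  have hDB := hD.subset.trans (Finset.erase_subset _ _)
  have hne : (C ∩ D).Nonempty := by
    rw [← Finset.card_pos]
    have := Finset.card_union_add_card_inter C D
    have := Finset.card_le_card (Finset.union_subset hCB hDB)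
    omega
  obtain ⟨i, hi⟩ := hne
  rw [Finset.mem_inter] at hi
  ext j
  exact ⟨fun hj => hD.mem hi.2 (hC.subset hj) (hC.connAvoid hi.1 hj),
    fun hj => hC.mem hi.1 (hD.subset hj) (hD.connAvoid hi.2 hj)⟩

open Classical in
-- For each `v` at most one class misses no more than an eighth of `B`, since two such classes would
-- overlap. So a single small set `U = B \ C`, independent of `W`, serves each `v`; a union bound
-- over `v` gives the factor `|B|`.
theorem card_not_representative_mul_pow_le (G : SimpleGraph V) {B : Finset V} {m k : ℕ}
    (hk : k = (m + 1) / 2) (hm : 1 ≤ m) (hmB : m ≤ B.card) :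
    ((B.powersetCard m).filter (fun W => ¬ Representative G B W)).card * 2 ^ k ≤
      B.card * B.card.choose m := by
  let bad : V → Finset (Finset V) := fun v => (B.powersetCard m).filter fun W =>
    ∃ C, IsClass G v (B.erase v) C ∧ 2 * (W ∩ C).card ≤ W.card ∧ 8 * (B \ C).card ≤ B.card
  have hbad : ∀ v, (bad v).card * 2 ^ k ≤ B.card.choose m := by
    intro v
    by_cases hC : ∃ C, IsClass G v (B.erase v) C ∧ 8 * (B \ C).card ≤ B.card
    · obtain ⟨C, hC, hC8⟩ := hC
      refine le_trans (Nat.mul_le_mul_right _ (Finset.card_le_card ?_))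
        (card_filter_inter_mul_pow_le (k := k) (m := m) (by omega) (by omega) hC8)
      intro W hW
      rw [Finset.mem_filter] at hW ⊢
      obtain ⟨hW, D, hD, hDW, hD8⟩ := hW
      refine ⟨hW, ?_⟩
      have hCB := hC.subset.trans (Finset.erase_subset _ _)
      have hDB := hD.subset.trans (Finset.erase_subset _ _)
      have h1 := Finset.card_sdiff_add_card_eq_card hCB
      have h2 := Finset.card_sdiff_add_card_eq_card hDB
      obtain rfl : C = D := hC.eq_of_card_lt hD (by omega)
      rw [Finset.mem_powersetCard] at hW
      have h3 : (W ∩ (B \ C)).card + (W ∩ C).card = W.card := by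
        rw [← Finset.inter_sdiff_assoc, Finset.inter_eq_left.2 hW.1]
        exact Finset.card_sdiff_add_card_inter W C
      omega
    · have : bad v = ∅ := Finset.filter_false_of_mem fun W _ ⟨C, h1, _, h2⟩ => hC ⟨C, h1, h2⟩
      simp [this]
  have hsub : (B.powersetCard m).filter (fun W => ¬ Representative G B W) ⊆ B.biUnion bad := by
    intro W hW
    rw [Finset.mem_filter] at hW
    obtain ⟨hW, hrep⟩ := hW
    simp only [Representative, not_forall, not_lt] at hrep
    obtain ⟨v, hv, C, hC, h1, h2⟩ := hrep
    exact Finset.mem_biUnion.2 ⟨v, hv, Finset.mem_filter.2 ⟨hW, C, hC, h1, h2⟩⟩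
  calc _ ≤ (∑ v ∈ B, (bad v).card) * 2 ^ k :=
        Nat.mul_le_mul_right _ ((Finset.card_le_card hsub).trans Finset.card_biUnion_le)
    _ = ∑ v ∈ B, (bad v).card * 2 ^ k := Finset.sum_mul _ _ _
    _ ≤ _ := by
      rw [← smul_eq_mul (a := B.card)]
      exact Finset.sum_le_card_nsmul _ _ _ fun v _ => hbad v

open Classical in
theorem card_not_representative_div_le (G : SimpleGraph V) {B : Finset V} {m : ℕ}
    (hm : 1 ≤ m) (hmB : m ≤ B.card) :
    ((((B.powersetCard m).filter (fun W => ¬ Representative G B W)).card : ℕ) : ℝ≥0∞) /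
      ((B.powersetCard m).card : ℕ) ≤ B.card * (2 ^ ((m + 1) / 2))⁻¹ := by
  have h := card_not_representative_mul_pow_le G rfl hm hmB
  have hpos : 0 < B.card.choose m := Nat.choose_pos hmB
  rw [Finset.card_powersetCard]
  refine ENNReal.div_le_of_le_mul ?_
  rw [mul_right_comm, ← div_eq_mul_inv, ENNReal.le_div_iff_mul_le (by simp) (by simp)]
  exact_mod_cast h

end Sampling

/-! ### The subroutines -/

section Partitions

variable {V : Type} {G : SimpleGraph V} {Cov : Matrix V V ℝ} {B W : Finset V} {v : V}

theorem foldr_max_le_iff {Cs : List (Finset V)} {N : ℕ} :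
    Cs.foldr (fun C r => max C.card r) 0 ≤ N ↔ ∀ C ∈ Cs, C.card ≤ N := by
  induction Cs with
  | nil => simp
  | cons C Cs ih => simp [ih]

theorem estimate_le_half_iff {Cs : List (Finset V)} (hB : B.Nonempty) (hW : W.Nonempty) :
    estimate B W Cs ≤ (B.card : ℚ) / 2 ↔ ∀ C ∈ Cs, 2 * C.card ≤ W.card := by
  have hB' : (0 : ℚ) < B.card := by exact_mod_cast hB.card_pos
  have hW' : (0 : ℚ) < W.card := by exact_mod_cast hW.card_pos
  have h1 : estimate B W Cs ≤ (B.card : ℚ) / 2 ↔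
      2 * Cs.foldr (fun C r => max C.card r) 0 ≤ W.card := by
    rw [estimate, div_le_div_iff₀ hW' two_pos, mul_assoc, mul_le_mul_iff_right₀ hB', mul_comm]
    exact_mod_cast Iff.rfl
  rw [h1]
  have h2 := foldr_max_le_iff (Cs := Cs) (N := W.card / 2)
  simp only [Nat.le_div_iff_mul_le two_pos, mul_comm _ 2] at h2
  exact h2

variable [DecidableEq V]

/-- A lone class would be `B.erase v` and contain at least `|W| - 1` sample points, more than half
once `|W| ≥ 3`. This holds for every sample, so termination does not depend on luck. -/
theorem IsPartition.two_le_length {Cs : List (Finset V)} (hCs : IsPartition G v (B.erase v) Cs)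
    (hv : v ∈ B) (hW : W ⊆ B) (hW3 : 3 ≤ W.card) (h : ∀ C ∈ Cs, 2 * (W ∩ C).card ≤ W.card) :
    2 ≤ Cs.length := by
  have hB := Finset.card_le_card hW
  have hsum := hCs.sum_card
  rw [Finset.card_erase_of_mem hv] at hsum
  match Cs with
  | [] =>
    simp only [List.map_nil, List.sum_nil] at hsum
    omega
  | [C] =>
    simp only [List.map_cons, List.map_nil, List.sum_cons, List.sum_nil, add_zero] at hsum
    have hC : C = B.erase v := Finset.eq_of_subset_of_card_le (hCs.isClass C (by simp)).subset
      (by rw [Finset.card_erase_of_mem hv, hsum])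
    have h1 := h C (by simp)
    have h2 : W.erase v ⊆ W ∩ C := fun j hj => by
      rw [Finset.mem_erase] at hj
      rw [hC, Finset.mem_inter, Finset.mem_erase]
      exact ⟨hj.2, hj.1, hW hj.2⟩
    have h3 := Finset.card_le_card h2
    have h4 := Finset.pred_card_le_card_erase (s := W) (a := v)
    omega
  | _ :: _ :: _ =>
    simp only [List.length_cons]
    omega

theorem two_mul_card_inter_le {Cs Ds : List (Finset V)} (hCs : IsPartition G v (W.erase v) Cs)
    (hDs : IsPartition G v (B.erase v) Ds) (hle : ∀ C ∈ Cs, 2 * C.card ≤ W.card) :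
    ∀ D ∈ Ds, 2 * (W ∩ D).card ≤ W.card := by
  intro D hD
  have hclass := hDs.isClass D hD
  rcases (W ∩ D).eq_empty_or_nonempty with he | ⟨i, hi⟩
  · simp [he]
  have herase : W ∩ D ⊆ W.erase v := fun j hj => by
    rw [Finset.mem_inter] at hj
    exact Finset.mem_erase.2 ⟨Finset.ne_of_mem_erase (hclass.subset hj.2), hj.1⟩
  obtain ⟨C, hC, hiC⟩ := hCs.exists_mem i (herase hi)
  refine (Nat.mul_le_mul_left 2 (Finset.card_le_card fun j hj => ?_)).trans (hle C hC)
  exact (hCs.isClass C hC).mem hiC (herase hj)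
    (hclass.connAvoid (Finset.mem_inter.1 hi).2 (Finset.mem_inter.1 hj).2)

/-- Each round yields one class and looks at fewer than `|A|` entries of four queries each, so the
number of classes controls the cost. -/
theorem components_holds {entry : V → V → Comp V ℝ}
    (hentry : ∀ i j, i ≠ v → j ≠ v →
      HoldsUpTo Cov 0 (entry i j) fun x q => (x ≠ 0 ↔ ConnAvoid G v i j) ∧ q ≤ 4)
    (A : Finset V) (hA : v ∉ A) :
    HoldsUpTo Cov 0 (components entry A)
      fun Cs q => IsPartition G v A Cs ∧ q ≤ Cs.length * (4 * A.card) := by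
  induction hN : A.card using Nat.strong_induction_on generalizing A with
  | _ N ih =>
  rw [components]
  split_ifs with hne
  · refine (HoldsUpTo.uniform A hne (fun _ => True) (by simp)).bind_zero fun i q hi => ?_
    have hiv : i.1 ≠ v := fun h => hA (h ▸ i.2)
    refine (HoldsUpTo.collect (P := fun j x => x ≠ 0 ↔ ConnAvoid G v j i.1) (k := 4) _
      fun j hj => ?_).bind_zero fun x q' hx => ?_
    · have hjA := Finset.mem_of_mem_erase (Finset.mem_toList.1 hj)
      exact hentry j i.1 (fun h => hA (h ▸ hjA)) hiv
    set C := insert i.1 ((A.erase i.1).filter fun j => x j ≠ 0) with hC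
    have hmem : ∀ j, j ∈ C ↔ j ∈ A ∧ ConnAvoid G v i.1 j := by
      intro j
      rw [hC, Finset.mem_insert, Finset.mem_filter]
      by_cases hj : j = i.1
      · subst hj
        simp [i.2, ConnAvoid.refl hiv]
      · constructor
        · rintro (h | h)
          · exact absurd h hj
          · exact ⟨Finset.mem_of_mem_erase h.1, ((hx.1 j (Finset.mem_toList.2 h.1)).1 h.2).symm⟩
        · rintro ⟨h1, h2⟩
          have h1 := Finset.mem_erase.2 ⟨hj, h1⟩
          exact Or.inr ⟨h1, (hx.1 j (Finset.mem_toList.2 h1)).2 h2.symm⟩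
    have hCA : C ⊆ A := fun j hj => ((hmem j).1 hj).1
    refine (ih _ (hN ▸ card_sdiff_insert_lt i.2 _) (A \ C)
      (fun h => hA (Finset.sdiff_subset h)) rfl).bind_zero fun Cs q'' hCs => ?_
    refine HoldsUpTo.ret ⟨⟨?_, ?_, ?_, ?_⟩, ?_⟩
    · rw [List.forall_mem_cons]
      refine ⟨⟨i.1, (hmem _).2 ⟨i.2, ConnAvoid.refl hiv⟩, hmem⟩, fun D hD => ?_⟩
      -- A class of `A \ C` is a class of `A`, as nothing outside `C` connects to `C` without `v`.
      obtain ⟨j, hj, hDj⟩ := hCs.1.isClass D hD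
      have hjA := Finset.mem_sdiff.1 ((hDj j).1 hj).1
      refine ⟨j, hj, fun l => ?_⟩
      rw [hDj, Finset.mem_sdiff]
      refine ⟨fun h => ⟨h.1.1, h.2⟩, fun h => ⟨⟨h.1, fun hlC => hjA.2 ?_⟩, h.2⟩⟩
      exact (hmem j).2 ⟨hjA.1, ((hmem l).1 hlC).2.trans h.2.symm⟩
    · intro j hj
      by_cases hjC : j ∈ C
      · exact ⟨C, by simp, hjC⟩
      · obtain ⟨D, hD, hjD⟩ := hCs.1.exists_mem j (Finset.mem_sdiff.2 ⟨hj, hjC⟩)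
        exact ⟨D, by simp [hD], hjD⟩
    · rw [List.pairwise_cons]
      exact ⟨fun D hD => Finset.disjoint_of_subset_right (hCs.1.isClass D hD).subset
        Finset.disjoint_sdiff, hCs.1.disjoint⟩
    · rw [List.map_cons, List.sum_cons, hCs.1.sum_card, add_comm,
        Finset.card_sdiff_add_card_eq_card hCA]
    · have h1 := hx.2
      rw [Finset.length_toList, Finset.card_erase_of_mem i.2] at h1
      have h2 : Cs.length * (4 * (A \ C).card) ≤ Cs.length * (4 * A.card) :=
        Nat.mul_le_mul_left _ (Nat.mul_le_mul_left _ (Finset.card_le_card Finset.sdiff_subset))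
      have h3 := hCs.2
      rw [List.length_cons, Nat.succ_mul, ← hN]
      have := hi.2
      omega
  · rw [Finset.not_nonempty_iff_eq_empty] at hne
    subst hne
    exact HoldsUpTo.ret ⟨⟨by simp, by simp, by simp, by simp⟩, by simp⟩

end Partitions

section Subroutines

variable {V : Type} [Fintype V] [DecidableEq V] {G : SimpleGraph V} {Cov : Matrix V V ℝ}
  {B : Finset V} {v : V}

theorem condEntry_holds (h : Cov ∈ faithfulModel 1 G) {i j : V} (hi : i ≠ v) (hj : j ≠ v) :
    HoldsUpTo Cov 0 (condEntry v i j) fun x q => (x ≠ 0 ↔ ConnAvoid G v i j) ∧ q ≤ 4 := by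
  refine (HoldsUpTo.ask i j).bind_zero fun a q ha => ?_
  refine (HoldsUpTo.ask i v).bind_zero fun b q' hb => ?_
  refine (HoldsUpTo.ask v j).bind_zero fun c q'' hc => ?_
  refine (HoldsUpTo.ask v v).bind_zero fun e q''' he => ?_
  refine HoldsUpTo.ret ⟨?_, by omega⟩
  rw [ha.1, hb.1, hc.1, he.1]
  exact condEntry_ne_zero_iff_of_faithful h hi hj

theorem directTest_holds (hG : G.Connected) (h : Cov ∈ faithfulModel 1 G)
    (hB : PathClosed G B) (hne : B.Nonempty) :
    HoldsUpTo Cov 0 (directTest B) fun b q =>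
      (b = true ↔ CycleFreeOn G B) ∧ q ≤ B.card * B.card := by
  classical
  refine (HoldsUpTo.collect (P := fun i g => ∀ j ∈ B.toList, g j = Cov i j)
    (k := B.toList.length * 1) _ fun i _ => ?_).bind_zero fun x q hx => ?_
  · exact HoldsUpTo.collect _ fun j _ => (HoldsUpTo.ask i j).imp fun _ _ h => ⟨h.1, h.2.le⟩
  simp only [Finset.mem_toList, Finset.length_toList, mul_one] at hx
  refine HoldsUpTo.ret ⟨?_, by omega⟩
  rw [decide_eq_true_iff, ← inverseGraph_isTree_iff hG h hB hne, inverseGraph]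
  have : (Matrix.of fun i j : B => x i.1 j.1) = Matrix.of fun i j : B => Cov i.1 j.1 := by
    ext i j
    exact hx.1 i.1 i.2 j.1 j.2
  rw [this]

variable [DecidableRel G.Adj]

theorem components_condEntry_holds (hG : G.Connected) (h : Cov ∈ faithfulModel 1 G)
    (A : Finset V) (hA : v ∉ A) :
    HoldsUpTo Cov 0 (components (condEntry v) A) fun Cs q =>
      IsPartition G v A Cs ∧ q ≤ min A.card G.maxDegree * (4 * A.card) := by
  refine (components_holds (fun i j => condEntry_holds h) A hA).imp fun Cs q hCs => ⟨hCs.1, ?_⟩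
  exact hCs.2.trans (Nat.mul_le_mul_right _ (le_min hCs.1.length_le_card
    ((hCs.1.length_le_degree hG).trans (G.degree_le_maxDegree v))))

/-- `P` is a free property of the sample: the trivial one gives sure correctness, `Representative`
gives the cost bound. -/
theorem findBalancedPartitionTree_holds (hG : G.Connected) (h : Cov ∈ faithfulModel 1 G)
    {tie : Finset V → Finset V → Finset V → V} (htie : ∀ B W s, s.Nonempty → tie B W s ∈ s)
    {m : ℕ} (hm3 : 3 ≤ m) (hB : PathClosed G B) (hm : m ≤ B.card) {δ : ℝ≥0∞}
    (P : Finset V → Prop) [DecidablePred P]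
    (hP : ((((B.powersetCard m).filter (fun W => ¬ P W)).card : ℕ) : ℝ≥0∞) /
      ((B.powersetCard m).card : ℕ) ≤ δ) :
    HoldsUpTo Cov δ (findBalancedPartitionTree tie m B hm) fun r q =>
      q ≤ 4 * B.card * (m * min m G.maxDegree + G.maxDegree) ∧
      (r = none → ¬ CycleFreeOn G B) ∧
      ∀ v Cs, r = some (v, Cs) → v ∈ B ∧ IsPartition G v (B.erase v) Cs ∧ 2 ≤ Cs.length ∧
        ∃ W, P W ∧ ∀ C ∈ Cs, 2 * (W ∩ C).card ≤ W.card := by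
  rw [← add_zero δ]
  refine (HoldsUpTo.uniform _ (Finset.powersetCard_nonempty.2 hm) P hP).bind fun W q hPW => ?_
  obtain ⟨W, hW⟩ := W
  obtain ⟨hPW, hq⟩ := hPW
  rw [Finset.mem_powersetCard] at hW
  have hWne : W.Nonempty := Finset.card_pos.1 (by omega)
  have hBne : B.Nonempty := hWne.mono hW.1
  refine (HoldsUpTo.collect (P := fun v x => ∃ Cs, IsPartition G v (W.erase v) Cs ∧
    x = estimate B W Cs) (k := min m G.maxDegree * (4 * m)) _ fun v _ => ?_).bind_zero
    fun Mhat q' hM => ?_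
  · refine (components_condEntry_holds hG h (W.erase v) (Finset.notMem_erase v W)).bind_zero
      fun Cs q hCs => HoldsUpTo.ret ⟨⟨Cs, hCs.1, rfl⟩, ?_⟩
    have hle : (W.erase v).card ≤ m := (Finset.card_erase_le).trans hW.2.le
    exact hCs.2.trans (Nat.mul_le_mul (min_le_min_right _ hle) (Nat.mul_le_mul_left _ hle))
  simp only [Finset.mem_toList] at hM
  dsimp only
  obtain ⟨u, hu, hu_min⟩ := B.exists_min_image Mhat hBne
  have hmem (inst : DecidablePred fun v => ∀ u ∈ B, Mhat v ≤ Mhat u) :=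
    Finset.mem_filter.1 (htie B W (@Finset.filter V _ inst B) ⟨u, Finset.mem_filter.2 ⟨hu, hu_min⟩⟩)
  generalize hvstar : tie B W _ = vstar
  have hmin : vstar ∈ B ∧ ∀ u ∈ B, Mhat vstar ≤ Mhat u := by
    rw [← hvstar]
    exact hmem _
  have hcost : q + q' ≤ B.card * (min m G.maxDegree * (4 * m)) := by
    rw [hq, zero_add, ← Finset.length_toList]
    exact hM.2
  have hcost' : 4 * B.card * (m * min m G.maxDegree + G.maxDegree) =
      B.card * (min m G.maxDegree * (4 * m)) + G.maxDegree * (4 * B.card) := by ring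
  split_ifs with hlt
  · refine HoldsUpTo.ret ⟨by omega, fun _ hc => ?_, by simp⟩
    -- A centroid for the weight `W` has estimate at most `|B| / 2`, and `vstar` does no worse.
    obtain ⟨u, hu, hCu⟩ := exists_centroid hG hB hc hBne hW.1
    obtain ⟨Cs, hCs, hest⟩ := hM.1 u hu
    have := (estimate_le_half_iff (Cs := Cs) hBne hWne).2 fun C hC => hCu C (hCs.isClass C hC)
    rw [← hest] at this
    exact absurd (hlt.trans_le ((hmin.2 u hu).trans this)) (lt_irrefl _)
  · refine (components_condEntry_holds hG h (B.erase vstar)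
      (Finset.notMem_erase _ B)).bind_zero fun Ds q'' hDs => HoldsUpTo.ret ⟨?_, by simp, ?_⟩
    · have : q'' ≤ G.maxDegree * (4 * B.card) := hDs.2.trans
        (Nat.mul_le_mul (min_le_right _ _) (Nat.mul_le_mul_left _ Finset.card_erase_le))
      omega
    · intro v Cs hv
      rw [Option.some.injEq, Prod.mk.injEq] at hv
      obtain ⟨rfl, rfl⟩ := hv
      obtain ⟨Cs, hCs, hest⟩ := hM.1 _ hmin.1
      rw [not_lt, hest, estimate_le_half_iff hBne hWne] at hlt
      have hle := two_mul_card_inter_le hCs hDs.1 hlt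
      exact ⟨hmin.1, hDs.1, hDs.1.two_le_length hmin.1 hW.1 (by omega) hle, W, hPW, hle⟩

end Subroutines

/-! ### The recursion -/

section Recursion

theorem IsPartition.card_insert {V : Type} [DecidableEq V] {G : SimpleGraph V} {v : V}
    {B C : Finset V} {Cs : List (Finset V)} (hCs : IsPartition G v (B.erase v) Cs) (hC : C ∈ Cs) :
    (insert v C).card = C.card + 1 :=
  Finset.card_insert_of_notMem fun h => Finset.notMem_erase v B ((hCs.isClass C hC).subset h)

theorem IsPartition.card_add_two_le {V : Type} [DecidableEq V] {G : SimpleGraph V} {v : V}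
    {B C : Finset V} {Cs : List (Finset V)} (hv : v ∈ B) (hCs : IsPartition G v (B.erase v) Cs)
    (hlen : 2 ≤ Cs.length) (hC : C ∈ Cs) : C.card + 2 ≤ B.card := by
  have hsum := hCs.sum_card
  rw [Finset.card_erase_of_mem hv, ((List.perm_cons_erase hC).map Finset.card).sum_eq,
    List.map_cons, List.sum_cons] at hsum
  have hlen' : (Cs.erase C).length = Cs.length - 1 := List.length_erase_of_mem hC
  have hle : ((Cs.erase C).map Finset.card).length ≤ ((Cs.erase C).map Finset.card).sum := by
    refine List.length_le_sum_of_one_le _ fun k hk => ?_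
    obtain ⟨D, hD, rfl⟩ := List.mem_map.1 hk
    exact (hCs.isClass D (List.mem_of_mem_erase hD)).nonempty.card_pos
  rw [List.length_map] at hle
  omega

theorem sum_map_le_mul_sum_card {V : Type} {Cs : List (Finset V)} {κ : Finset V → ℝ} {a : ℝ}
    (h : ∀ C ∈ Cs, κ C ≤ a * C.card) : (Cs.map κ).sum ≤ a * ((Cs.map Finset.card).sum : ℕ) := by
  induction Cs with
  | nil => simp
  | cons C Cs ih =>
    have h1 := h C (by simp)
    have h2 := ih fun D hD => h D (by simp [hD])
    simp only [List.map_cons, List.sum_cons]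
    push_cast
    push_cast at h2
    linarith

theorem sum_map_card_sub_one {V : Type} {Cs : List (Finset V)} (η : ℝ≥0∞)
    (h : ∀ C ∈ Cs, C.Nonempty) :
    (Cs.map fun C => ((C.card - 1 : ℕ) : ℝ≥0∞) * η).sum =
      (((Cs.map Finset.card).sum - Cs.length : ℕ) : ℝ≥0∞) * η := by
  have key : (Cs.map fun C => ((C.card - 1 : ℕ) : ℝ≥0∞) * η).sum =
      ((Cs.map fun C => C.card - 1).sum : ℕ) * η := by
    clear h
    induction Cs with
    | nil => simp
    | cons C Cs ih =>
      simp only [List.map_cons, List.sum_cons, ih]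
      push_cast
      ring
  have hnat : (Cs.map fun C => C.card - 1).sum + Cs.length = (Cs.map Finset.card).sum := by
    clear key
    induction Cs with
    | nil => simp
    | cons C Cs ih =>
      have h1 := (h C (by simp)).card_pos
      have h2 := ih fun D hD => h D (by simp [hD])
      simp only [List.map_cons, List.sum_cons, List.length_cons]
      omega
  rw [key, ← hnat, Nat.add_sub_cancel]

/-- The bound on the number of queries of a run on `b + 1` vertices whose splits are all
balanced. -/
def queryBound (X b : ℕ) : ℝ :=
  8 * X * b * (1 + 10 * Real.log b)

theorem queryBound_nonneg (X b : ℕ) : 0 ≤ queryBound X b := by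
  have := Real.log_natCast_nonneg b
  unfold queryBound
  positivity

theorem mul_le_queryBound (X b : ℕ) : 8 * X * b ≤ queryBound X b := by
  have := Real.log_natCast_nonneg b
  exact le_mul_of_one_le_right (by positivity) (by linarith)

/-- Shrinking by 9/10 lowers the logarithm by at least 1/10, so `10 * log` drops by 1; this absorbs
the summand 1 and frees `8 * X * c`. -/
theorem queryBound_le_of_balanced {X b c : ℕ} (hc : 1 ≤ c) (h : 10 * c ≤ 9 * b) :
    queryBound X c ≤ 80 * X * Real.log b * c := by
  have hc' : (0 : ℝ) < c := by exact_mod_cast hc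
  have hb' : (0 : ℝ) < b := by exact_mod_cast (by omega : 0 < b)
  have h' : 10 * (c : ℝ) ≤ 9 * b := by exact_mod_cast h
  have h1 : Real.log ((c : ℝ) / b) ≤ (c : ℝ) / b - 1 := Real.log_le_sub_one_of_pos (by positivity)
  have h2 : (c : ℝ) / b ≤ 9 / 10 := by
    rw [div_le_div_iff₀ hb' (by norm_num)]
    linarith
  rw [Real.log_div hc'.ne' hb'.ne'] at h1
  have h3 : 1 + 10 * Real.log c ≤ 10 * Real.log b := by linarith
  calc queryBound X c ≤ 8 * X * c * (10 * Real.log b) :=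
        mul_le_mul_of_nonneg_left h3 (by positivity)
    _ = _ := by ring

variable {V : Type} [Fintype V] [DecidableEq V] {G : SimpleGraph V} [DecidableRel G.Adj]
  {Cov : Matrix V V ℝ} {tie : Finset V → Finset V → Finset V → V} {m : ℕ}

theorem testTree_result (hG : G.Connected) (h : Cov ∈ faithfulModel 1 G)
    (htie : ∀ B W s, s.Nonempty → tie B W s ∈ s) (hm : 3 ≤ m) (d : ℕ) (B : Finset V)
    (hB : PathClosed G B) (hB2 : 2 ≤ B.card) (hd : B.card ≤ d) :
    HoldsUpTo Cov 0 (testTree tie m d B)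
      fun r _ => ∃ b : Bool, r = some b ∧ (b = true ↔ CycleFreeOn G B) := by
  induction d generalizing B with
  | zero => omega
  | succ d ih =>
    rw [testTree]
    split_ifs with hBm
    · refine (directTest_holds hG h hB (Finset.card_pos.1 (by omega))).bind_zero
        fun b q hb => HoldsUpTo.ret ⟨b, rfl, hb.1⟩
    · refine (findBalancedPartitionTree_holds hG h htie hm hB (not_le.1 hBm).le (fun _ => True)
        (by simp)).bind_zero fun r q hr => ?_
      obtain ⟨-, hnone, hsome⟩ := hr
      match r with
      | none =>
        refine HoldsUpTo.ret ⟨false, rfl, ?_⟩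
        simpa using hnone rfl
      | some (v, Cs) =>
        obtain ⟨hv, hCs, hlen, -⟩ := hsome v Cs rfl
        have hall := HoldsUpTo.allAccept_result (Cov := Cov)
          (ps := fun C => testTree tie m d (insert v C)) (T := fun C => CycleFreeOn G (insert v C))
          Cs fun C hC => by
            have h1 := hCs.card_insert hC
            have h2 := hCs.card_add_two_le hv hlen hC
            have h3 := (hCs.isClass C hC).nonempty.card_pos
            exact ih _ (hB.insert_isClass hv (hCs.isClass C hC)) (by omega) (by omega)
        refine hall.imp fun r _ hr => ?_
        rwa [cycleFreeOn_iff_forall_isPartition hv hCs]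

/-- The failure budget is one unit per split. The pieces need `|C| - 1` units each, at most `|B| -
3` in total because there are at least two classes, which leaves one unit for the current sample. -/
theorem testTree_cost (hG : G.Connected) (h : Cov ∈ faithfulModel 1 G)
    (htie : ∀ B W s, s.Nonempty → tie B W s ∈ s) (hm : 36 ≤ m) (hΔ : 1 ≤ G.maxDegree)
    (d : ℕ) (B : Finset V) (hB : PathClosed G B) (hB2 : 2 ≤ B.card) (hd : B.card ≤ d) :
    HoldsUpTo Cov ((B.card - 2 : ℕ) * (Fintype.card V * (2 ^ ((m + 1) / 2))⁻¹))
      (testTree tie m d B) fun _ q =>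
        (q : ℝ) ≤ queryBound (m * min m G.maxDegree + G.maxDegree) (B.card - 1) := by
  classical
  set X := m * min m G.maxDegree + G.maxDegree with hX
  set η : ℝ≥0∞ := Fintype.card V * (2 ^ ((m + 1) / 2))⁻¹ with hη
  induction d generalizing B with
  | zero => omega
  | succ d ih =>
    have hbB : B.card ≤ 2 * (B.card - 1) := by omega
    rw [testTree]
    split_ifs with hBm
    · rw [← zero_add (((B.card - 2 : ℕ) : ℝ≥0∞) * η)]
      refine (directTest_holds hG h hB (Finset.card_pos.1 (by omega))).bind
        fun b q hb => HoldsUpTo.ret (le_trans ?_ (mul_le_queryBound _ _))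
      have hmX : m ≤ X := by
        have : 1 ≤ min m G.maxDegree := le_min (by omega) hΔ
        have := Nat.le_mul_of_pos_right m this
        omega
      have : q + 0 ≤ 8 * X * (B.card - 1) := by
        calc q + 0 ≤ B.card * B.card := hb.2
          _ ≤ m * (2 * (B.card - 1)) := Nat.mul_le_mul hBm hbB
          _ ≤ (4 * X) * (2 * (B.card - 1)) := Nat.mul_le_mul_right _ (by omega)
          _ = _ := by ring
      exact_mod_cast this
    · have hstep := findBalancedPartitionTree_holds hG h htie (by omega) hB (not_le.1 hBm).le
        (Representative G B) (card_not_representative_div_le G (by omega) (not_le.1 hBm).le)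
      have hδ : (B.card : ℝ≥0∞) * (2 ^ ((m + 1) / 2))⁻¹ ≤ η := by
        rw [hη]
        gcongr
        exact Finset.card_le_univ B
      refine HoldsUpTo.mono (δ := η + ((B.card - 3 : ℕ) : ℝ≥0∞) * η)
        ((hstep.mono hδ fun _ _ => id).bind fun r q hr => ?_) ?_ fun _ _ => id
      · obtain ⟨hq, -, hsome⟩ := hr
        have hq' : (q : ℝ) ≤ 8 * X * (B.card - 1 : ℕ) := by
          have : q ≤ 8 * X * (B.card - 1) := by
            calc q ≤ 4 * B.card * X := hq
              _ ≤ 4 * (2 * (B.card - 1)) * X := by gcongr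
              _ = _ := by ring
          exact_mod_cast this
        match r with
        | none =>
          refine HoldsUpTo.ret ?_
          rw [add_zero]
          exact hq'.trans (mul_le_queryBound _ _)
        | some (v, Cs) =>
          obtain ⟨hv, hCs, hlen, W, hW, hle⟩ := hsome v Cs rfl
          have hsum := hCs.sum_card
          rw [Finset.card_erase_of_mem hv] at hsum
          have hall := HoldsUpTo.allAccept (Cov := Cov)
            (ps := fun C => testTree tie m d (insert v C)) (κ := fun C => queryBound X C.card)
            (η := fun C => ((C.card - 1 : ℕ) : ℝ≥0∞) * η) (fun C => queryBound_nonneg _ _)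
            Cs fun C hC => by
              have h1 := hCs.card_insert hC
              have h2 := hCs.card_add_two_le hv hlen hC
              have h3 := (hCs.isClass C hC).nonempty.card_pos
              have h4 := ih _ (hB.insert_isClass hv (hCs.isClass C hC)) (by omega) (by omega)
              rw [h1] at h4
              exact h4
          refine hall.mono ?_ fun _ q' hq'' => ?_
          · rw [sum_map_card_sub_one η fun C hC => (hCs.isClass C hC).nonempty, hsum]
            exact mul_le_mul' (Nat.cast_le.2 (by omega)) le_rfl
          · have hbal : ∀ C ∈ Cs, queryBound X C.card ≤
                80 * X * Real.log (B.card - 1 : ℕ) * C.card := by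
              intro C hC
              have h1 := hW v hv C (hCs.isClass C hC) (hle C hC)
              have h2 := Finset.card_sdiff_add_card_eq_card
                ((hCs.isClass C hC).subset.trans (Finset.erase_subset v B))
              -- From `8|C| < 7|B|` to `10|C| ≤ 9(|B| - 1)`: the slack between 7/8 and 9/10 absorbs
              -- the shift by one because `|B| > m ≥ 36`.
              exact queryBound_le_of_balanced (hCs.isClass C hC).nonempty.card_pos (by omega)
            have h5 := sum_map_le_mul_sum_card hbal
            rw [hsum] at h5
            push_cast [queryBound] at *
            linarith
      · have : B.card - 2 = 1 + (B.card - 3) := by omega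
        rw [this, Nat.cast_add, Nat.cast_one, add_mul, one_mul]

end Recursion

/-! ### The sample size -/

section SampleSize

theorem log_div_le_log_sampleSize {n : ℕ} (hn : 2 ≤ n) {ε : ℝ} (hε : 0 < ε) :
    Real.log (n / ε) ≤ Real.log (5 * (n : ℝ) ^ 2 / ε * Real.log n) := by
  have hn' : (2 : ℝ) ≤ n := by exact_mod_cast hn
  have hlog : Real.log 2 ≤ Real.log n := Real.log_le_log (by norm_num) hn'
  have h2 := Real.log_two_gt_d9
  refine Real.log_le_log (by positivity) ?_
  calc (n : ℝ) / ε = n / ε * 1 := (mul_one _).symm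
    _ ≤ n / ε * (5 * n * Real.log n) := by
        refine mul_le_mul_of_nonneg_left ?_ (by positivity)
        nlinarith
    _ = _ := by ring

theorem log_sampleSize_le {n : ℕ} (hn : 2 ≤ n) {ε : ℝ} (hε : 0 < ε) (hε1 : ε < 1) :
    Real.log (5 * (n : ℝ) ^ 2 / ε * Real.log n) ≤ 6 * Real.log (n / ε) := by
  have hn' : (2 : ℝ) ≤ n := by exact_mod_cast hn
  have hlog : 0 < Real.log n := Real.log_pos (by linarith)
  have hlog' : Real.log n ≤ n := by
    have := Real.log_le_sub_one_of_pos (show (0 : ℝ) < n by linarith)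
    linarith
  have hle : 5 * (n : ℝ) ^ 2 / ε * Real.log n ≤ (n / ε) ^ 6 := by
    have h3 : (2 : ℝ) ^ 3 ≤ (n : ℝ) ^ 3 := by gcongr
    have hε6 : ε ^ 6 ≤ ε := by
      simpa using pow_le_pow_of_le_one hε.le hε1.le (show 1 ≤ 6 by norm_num)
    calc 5 * (n : ℝ) ^ 2 / ε * Real.log n ≤ 5 * (n : ℝ) ^ 2 / ε * n := by gcongr
      _ = 5 * (n : ℝ) ^ 3 / ε := by ring
      _ ≤ (n : ℝ) ^ 3 * (n : ℝ) ^ 3 / ε := by gcongr; linarith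
      _ = (n : ℝ) ^ 6 / ε := by ring
      _ ≤ (n : ℝ) ^ 6 / ε ^ 6 := by gcongr
      _ = _ := (div_pow _ _ _).symm
  calc _ ≤ Real.log ((n / ε) ^ 6) := Real.log_le_log (by positivity) hle
    _ = _ := by rw [Real.log_pow]; norm_num

theorem half_le_log_div {n : ℕ} (hn : 2 ≤ n) {ε : ℝ} (hε : 0 < ε) (hε1 : ε < 1) :
    1 / 2 ≤ Real.log (n / ε) := by
  have hn' : (2 : ℝ) ≤ n := by exact_mod_cast hn
  have h2 := Real.log_two_gt_d9
  have : (2 : ℝ) ≤ n / ε := by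
    rw [le_div_iff₀ hε]
    nlinarith
  have := Real.log_le_log (by norm_num) this
  linarith

theorem mul_min_add_le_of_le_mul {a b c D : ℝ} (ha : 0 ≤ a) (hb : 0 ≤ b) (hc : 1 ≤ c)
    (hD : 0 ≤ D) (h : a ≤ c * b) : a * min a D + D ≤ c ^ 2 * (b * min b D + D) := by
  have h1 : min a D ≤ c * min b D := by
    rw [mul_min_of_nonneg _ _ (by linarith)]
    exact min_le_min h (le_mul_of_one_le_left hD hc)
  have h2 : a * min a D ≤ c * b * (c * min b D) :=
    mul_le_mul h h1 (le_min ha hD) (by positivity)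
  have h3 : D ≤ c ^ 2 * D := le_mul_of_one_le_left hD (by nlinarith)
  linarith

/-- With `M` the argument of the logarithm, `2 ^ ⌈m/2⌉ ≥ M` since `9 * log 2 ≥ 1`, and `M ≥ n² / ε`
since `5 * log n ≥ 1`. -/
theorem sq_mul_inv_two_pow_le {n m : ℕ} (hn : 2 ≤ n) {ε : ℝ} (hε : 0 < ε)
    (hm : 18 * Real.log (5 * (n : ℝ) ^ 2 / ε * Real.log n) ≤ m) :
    (n : ℝ) ^ 2 * (2 ^ ((m + 1) / 2))⁻¹ ≤ ε := by
  have hn' : (2 : ℝ) ≤ n := by exact_mod_cast hn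
  have hlog : Real.log 2 ≤ Real.log n := Real.log_le_log (by norm_num) hn'
  have h2 := Real.log_two_gt_d9
  have hmk : (m : ℝ) ≤ 2 * ((m + 1) / 2 : ℕ) := by
    exact_mod_cast (by omega : m ≤ 2 * ((m + 1) / 2))
  have hpos : 0 < 5 * (n : ℝ) ^ 2 / ε * Real.log n := by
    have : 0 < Real.log n := by linarith
    positivity
  have hkey : Real.log (5 * (n : ℝ) ^ 2 / ε * Real.log n) ≤ Real.log (2 ^ ((m + 1) / 2)) := by
    rw [Real.log_pow]
    nlinarith [Nat.cast_nonneg (α := ℝ) ((m + 1) / 2)]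
  have hpow := (Real.log_le_log_iff hpos (by positivity)).1 hkey
  rw [← div_eq_mul_inv, div_le_iff₀ (by positivity)]
  calc (n : ℝ) ^ 2 = ε * ((n : ℝ) ^ 2 / ε) := by field_simp
    _ ≤ ε * (5 * (n : ℝ) ^ 2 / ε * Real.log n) := by
        refine mul_le_mul_of_nonneg_left ?_ hε.le
        have : (n : ℝ) ^ 2 / ε * 1 ≤ (n : ℝ) ^ 2 / ε * (5 * Real.log n) :=
          mul_le_mul_of_nonneg_left (by linarith) (by positivity)
        calc _ = (n : ℝ) ^ 2 / ε * 1 := (mul_one _).symm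
          _ ≤ _ := this
          _ = _ := by ring
    _ ≤ _ := mul_le_mul_of_nonneg_left hpow hε.le

theorem one_le_maxDegree {n : ℕ} (hn : 2 ≤ n) {G : SimpleGraph (Fin n)} [DecidableRel G.Adj]
    (hG : G.Connected) : 1 ≤ G.maxDegree := by
  have : Nontrivial (Fin n) := Fin.nontrivial_iff_two_le.2 hn
  exact (hG.preconnected.degree_pos_of_nontrivial ⟨0, by omega⟩).trans_le (G.degree_le_maxDegree _)

theorem cycleFreeOn_univ_iff {V : Type} [Fintype V] {G : SimpleGraph V} (hG : G.Connected) :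
    CycleFreeOn G Finset.univ ↔ G.IsTree := by
  have : G.IsTree ↔ G.IsAcyclic := ⟨fun h => h.2, fun h => ⟨hG, h⟩⟩
  rw [this, isAcyclic_iff_path_length]
  simp [CycleFreeOn]

end SampleSize

end TreeTest

end

/-! ### Assembly and choice of constants -/

theorem theorem3p5 :
    ∃ K : ℝ, 0 < K ∧
      ∀ (n : ℕ), 2 ≤ n →
      ∀ (G : SimpleGraph (Fin n)) [DecidableRel G.Adj], G.Connected →
      ∀ Cov ∈ TreeTest.faithfulModel 1 G,
      ∀ ε : ℝ, 0 < ε → ε < 1 →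
      ∀ m : ℕ, m = ⌈18 * Real.log (5 * (n : ℝ) ^ 2 / ε * Real.log n)⌉₊ →
      -- any rule that breaks ties between minimizers
      ∀ tie : Finset (Fin n) → Finset (Fin n) → Finset (Fin n) → Fin n,
      (∀ B W s, s.Nonempty → tie B W s ∈ s) →
      -- the recursion never gets deeper than `n`, so any `d ≥ n` gives the full algorithm
      ∀ d : ℕ, n ≤ d →
        (∀ x ∈ ((TreeTest.testTree tie m d Finset.univ).run Cov).support,
          ∃ b : Bool, x.1 = some b ∧ (b = true ↔ G.IsTree)) ∧
        ENNReal.ofReal (1 - ε) ≤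
          ((TreeTest.testTree tie m d Finset.univ).run Cov).toOuterMeasure
            {x | (x.2 : ℝ) ≤ K * (n * Real.log n *
              (m * min (m : ℝ) (G.maxDegree : ℝ) + (G.maxDegree : ℝ)))} ∧
        n * Real.log n * (m * min (m : ℝ) (G.maxDegree : ℝ) + (G.maxDegree : ℝ)) ≤
          K * (n * Real.log n *
            (Real.log (n / ε) * min (Real.log (n / ε)) (G.maxDegree : ℝ) + (G.maxDegree : ℝ))) ∧
        n * Real.log n *
            (Real.log (n / ε) * min (Real.log (n / ε)) (G.maxDegree : ℝ) + (G.maxDegree : ℝ)) ≤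
          K * (n * Real.log n *
            (m * min (m : ℝ) (G.maxDegree : ℝ) + (G.maxDegree : ℝ))) := by
  -- `12100 = 110²`, from `m ≤ 110 * L` and the quadratic dependence on `m`; the cost bound alone
  -- needs only 96.
  refine ⟨12100, by norm_num, ?_⟩
  intro n hn G _ hG Cov hCov ε hε hε1 m hm tie htie d hd
  have hn' : (2 : ℝ) ≤ n := by exact_mod_cast hn
  have hlog2 := Real.log_two_gt_d9
  have hlogn : Real.log 2 ≤ Real.log n := Real.log_le_log (by norm_num) hn'
  have hlogn0 : 0 < Real.log n := by linarith
  set L := Real.log (n / ε) with hL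
  have hL2 : 1 / 2 ≤ L := TreeTest.half_le_log_div hn hε hε1
  have hLM := TreeTest.log_div_le_log_sampleSize hn hε
  have hML := TreeTest.log_sampleSize_le hn hε hε1
  have hm1 : 18 * Real.log (5 * (n : ℝ) ^ 2 / ε * Real.log n) ≤ m := hm ▸ Nat.le_ceil _
  -- `18 * 6 = 108`, and rounding up costs `1 ≤ 2 * L`.
  have hm2 : (m : ℝ) ≤ 110 * L := by
    have := Nat.ceil_lt_add_one
      (show 0 ≤ 18 * Real.log (5 * (n : ℝ) ^ 2 / ε * Real.log n) by linarith)
    rw [← hm] at this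
    linarith
  have hm36 : 36 ≤ m := by
    have h8 : (8 : ℝ) ≤ 5 * (n : ℝ) ^ 2 / ε * Real.log n := by
      have h1 : (20 : ℝ) ≤ 5 * (n : ℝ) ^ 2 / ε := by
        rw [le_div_iff₀ hε]
        nlinarith
      nlinarith
    have h3 : Real.log 8 = 3 * Real.log 2 := by
      rw [show (8 : ℝ) = 2 ^ 3 by norm_num, Real.log_pow]
      norm_num
    have := Real.log_le_log (by norm_num) h8
    have : (36 : ℝ) ≤ m := by linarith
    exact_mod_cast this
  have hΔ := TreeTest.one_le_maxDegree hn hG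
  have hcl : TreeTest.PathClosed G Finset.univ := fun _ _ _ _ _ _ _ _ => Finset.mem_univ _
  have hcard : (Finset.univ : Finset (Fin n)).card = n := by simp
  have hD : (0 : ℝ) ≤ G.maxDegree := Nat.cast_nonneg _
  refine ⟨?_, ?_, ?_, ?_⟩
  · have := TreeTest.testTree_result hG hCov htie (by omega : 3 ≤ m) d Finset.univ hcl
      (by omega) (by omega)
    rw [TreeTest.HoldsUpTo.zero_iff] at this
    intro x hx
    obtain ⟨b, hb, hbt⟩ := this x hx
    exact ⟨b, hb, hbt.trans (TreeTest.cycleFreeOn_univ_iff hG)⟩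
  · have hcost := TreeTest.testTree_cost hG hCov htie hm36 hΔ d Finset.univ hcl
      (by omega) (by omega)
    rw [hcard, Fintype.card_fin] at hcost
    have hδ : ((n - 2 : ℕ) : ENNReal) * (n * (2 ^ ((m + 1) / 2))⁻¹) ≤ ENNReal.ofReal ε := by
      refine le_trans ?_ (ENNReal.ofReal_le_ofReal (TreeTest.sq_mul_inv_two_pow_le hn hε hm1))
      rw [ENNReal.ofReal_mul (by positivity), ENNReal.ofReal_pow (by positivity),
        ENNReal.ofReal_natCast, ENNReal.ofReal_inv_of_pos (by positivity),
        ENNReal.ofReal_pow (by norm_num), ENNReal.ofReal_ofNat, sq, mul_assoc]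
      gcongr
      omega
    have hgood := (hcost.mono (Q' := fun _ q => (q : ℝ) ≤ 12100 * (n * Real.log n *
      (m * min (m : ℝ) (G.maxDegree : ℝ) + (G.maxDegree : ℝ)))) hδ fun _ q hq => ?_).one_sub_le
    · rw [ENNReal.ofReal_sub _ hε.le, ENNReal.ofReal_one]
      exact hgood
    · refine hq.trans ?_
      have hX : ((m * min m G.maxDegree + G.maxDegree : ℕ) : ℝ) =
          m * min (m : ℝ) (G.maxDegree : ℝ) + (G.maxDegree : ℝ) := by push_cast; rfl
      rw [TreeTest.queryBound, ← hX]
      set X := m * min m G.maxDegree + G.maxDegree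
      have hn1 : ((n - 1 : ℕ) : ℝ) ≤ n := by exact_mod_cast Nat.sub_le n 1
      have hlog1 : Real.log (n - 1 : ℕ) ≤ Real.log n :=
        Real.log_le_log (by exact_mod_cast (by omega : 0 < n - 1)) hn1
      calc 8 * (X : ℝ) * (n - 1 : ℕ) * (1 + 10 * Real.log (n - 1 : ℕ))
          ≤ 8 * X * n * (12 * Real.log n) := by
            have := Real.log_natCast_nonneg (n - 1)
            gcongr
            linarith
        _ = 96 * (n * Real.log n * X) := by ring
        _ ≤ 12100 * (n * Real.log n * X) := by
            refine mul_le_mul_of_nonneg_right (by norm_num) (by positivity)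
  · have := TreeTest.mul_min_add_le_of_le_mul (Nat.cast_nonneg m) (by linarith : 0 ≤ L)
      (by norm_num : (1 : ℝ) ≤ 110) hD hm2
    calc _ ≤ n * Real.log n * (110 ^ 2 * (L * min L G.maxDegree + G.maxDegree)) :=
          mul_le_mul_of_nonneg_left this (by positivity)
      _ = _ := by ring
  · have := TreeTest.mul_min_add_le_of_le_mul (by linarith : 0 ≤ L) (Nat.cast_nonneg m)
      (by norm_num : (1 : ℝ) ≤ 110) hD (by linarith : L ≤ 110 * (m : ℝ))
    calc _ ≤ n * Real.log n * (110 ^ 2 * (m * min (m : ℝ) G.maxDegree + G.maxDegree)) :=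
          mul_le_mul_of_nonneg_left this (by positivity)
      _ = _ := by ring
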